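/- Let $K$ be an algebraically closed field. For $n\ge 1$ let $T_n$ be the set of upper triangular and $U_n$ the set of strictly upper triangular $n\times n$ matrices over $K$. Put $$CT_n=\{(X,Y)\in T_n\times T_n : [X,Y]=0\},\qquad NT_n=CT_n\cap(U_n\times U_n),$$ with the Zariski topology, and let $CT_n^0$ be the Zariski closure of the set of pairs $(X,Y)\in CT_n$ such that $X$ and $Y$ are both regular (that is, have minimal polynomial of degree $n$). Call $CT_n$ a complete intersection if the ideal generated by its $\frac{n(n-1)}2$ equations, the entries of $[X,Y]$ above the diagonal, in the coordinate ring of $T_n\times T_n$ has height $\frac{n(n-1)}2$. Let $n\ge 2$ and suppose that $CT_{n-1}$ is irreducible. If $(X,Y)\in CT_n$ and $X$ or $Y$ has at least two eigenvalues, then $(X,Y)\in CT_n^0$. Hence the irreducibility of $CT_n$ and the complete intersection property are decided by the variety $NT_n$, in the following sense: 1. if $Z$ is an irreducible component of $CT_n$ with $Z\ne CT_n^0$, then for every $(X,Y)\in Z$ each of $X$ and $Y$ has exactly one eigenvalue; 2. $CT_n$ is irreducible if and only if $NT_n\subseteq CT_n^0$, and also if and only if $\dim NT_n+2<\frac{n(n+3)}2$;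 3. $CT_n$ is a complete intersection if and only if $\dim NT_n+2\le\frac{n(n+3)}2$. -/

import Mathlib

noncomputable section

/-- The Zariski topology on the affine space `K^σ`: the closed sets are the sets of common zeros of
ideals of `K[x_s : s ∈ σ]`. -/
@[reducible] def zariskiTopology (σ K : Type*) [Field K] : TopologicalSpace (σ → K) :=
  TopologicalSpace.ofClosed
    (Set.range fun I : Ideal (MvPolynomial σ K) => MvPolynomial.zeroLocus K I)
    ⟨⊤, by simp⟩
    (by
      intro A hA
      refine ⟨⨆ I ∈ {I : Ideal (MvPolynomial σ K) | MvPolynomial.zeroLocus K I ∈ A}, I, ?_⟩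
      apply Set.Subset.antisymm
      · intro x hx Z hZ
        obtain ⟨I, rfl⟩ := hA hZ
        exact MvPolynomial.zeroLocus_anti_mono (le_iSup₂_of_le I hZ le_rfl) hx
      · intro x hx
        have h : (⨆ I ∈ {I : Ideal (MvPolynomial σ K) | MvPolynomial.zeroLocus K I ∈ A}, I) ≤
            MvPolynomial.vanishingIdeal K {x} :=
          iSup₂_le fun I hI p hp y hy => by
            rw [Set.mem_singleton_iff.1 hy]
            exact hx _ hI p hp
        exact fun p hp => h hp x rfl)
    (by
      rintro _ ⟨I, rfl⟩ _ ⟨J, rfl⟩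
      refine ⟨I * J, ?_⟩
      apply Set.Subset.antisymm
      · intro x hx
        by_contra hn
        simp only [Set.mem_union, not_or, MvPolynomial.mem_zeroLocus_iff, not_forall] at hn
        obtain ⟨⟨p, hp, hpx⟩, ⟨q, hq, hqx⟩⟩ := hn
        have h := hx (p * q) (Ideal.mul_mem_mul hp hq)
        rw [map_mul] at h
        exact (mul_ne_zero hpx hqx) h
      · rintro x (hx | hx)
        · exact MvPolynomial.zeroLocus_anti_mono Ideal.mul_le_left hx
        · exact MvPolynomial.zeroLocus_anti_mono Ideal.mul_le_right hx)

/-- Pairs `(X, Y)` of `n × n` matrices over `K`. -/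
@[ext]
structure MatPair (K : Type*) (n : ℕ) where
  X : Matrix (Fin n) (Fin n) K
  Y : Matrix (Fin n) (Fin n) K

namespace MatPair

/-- The `2n²` coordinates of a pair of matrices, i.e. the entries of the two matrices. -/
def coords {K : Type*} {n : ℕ} (p : MatPair K n) : (Fin n × Fin n) ⊕ (Fin n × Fin n) → K :=
  Sum.elim (fun ij => p.X ij.1 ij.2) (fun ij => p.Y ij.1 ij.2)

/-- Pairs of matrices carry the Zariski topology of the affine space of dimension `2n²`. -/
instance zariski {K : Type*} [Field K] {n : ℕ} : TopologicalSpace (MatPair K n) :=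
  TopologicalSpace.induced coords (zariskiTopology ((Fin n × Fin n) ⊕ (Fin n × Fin n)) K)

end MatPair

/-- `CT_n`: the commuting pairs of upper triangular `n × n` matrices. -/
def CT (K : Type*) [Field K] (n : ℕ) : Set (MatPair K n) :=
  {p | p.X.BlockTriangular id ∧ p.Y.BlockTriangular id ∧ p.X * p.Y = p.Y * p.X}

/-- `NT_n`: the pairs in `CT_n` with both matrices strictly upper triangular. -/
def NT (K : Type*) [Field K] (n : ℕ) : Set (MatPair K n) :=
  {p | p ∈ CT K n ∧ (∀ i j : Fin n, j ≤ i → p.X i j = 0) ∧ (∀ i j : Fin n, j ≤ i → p.Y i j = 0)}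

/-- A matrix is regular if its minimal polynomial has degree `n`. -/
def IsRegularMatrix {K : Type*} [Field K] {n : ℕ} (A : Matrix (Fin n) (Fin n) K) : Prop :=
  (minpoly K A).natDegree = n

/-- `CT_n^0`: the Zariski closure of the set of pairs in `CT_n` both of whose members are
regular. -/
def CT0 (K : Type*) [Field K] (n : ℕ) : Set (MatPair K n) :=
  closure {p | p ∈ CT K n ∧ IsRegularMatrix p.X ∧ IsRegularMatrix p.Y}

/-- The positions `(i, j)`, `i ≤ j`, of the entries of an upper triangular matrix. -/
abbrev UpperIndex (n : ℕ) : Type := {ij : Fin n × Fin n // ij.1 ≤ ij.2}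

/-- The coordinate ring of `T_n × T_n`: a polynomial ring in `n(n+1)` variables. -/
abbrev UpperPairRing (K : Type*) [Field K] (n : ℕ) : Type _ :=
  MvPolynomial (UpperIndex n ⊕ UpperIndex n) K

/-- The first generic upper triangular matrix. -/
def genericX (K : Type*) [Field K] (n : ℕ) : Matrix (Fin n) (Fin n) (UpperPairRing K n) :=
  Matrix.of fun i j => if h : i ≤ j then MvPolynomial.X (Sum.inl ⟨(i, j), h⟩) else 0

/-- The second generic upper triangular matrix. -/
def genericY (K : Type*) [Field K] (n : ℕ) : Matrix (Fin n) (Fin n) (UpperPairRing K n) :=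
  Matrix.of fun i j => if h : i ≤ j then MvPolynomial.X (Sum.inr ⟨(i, j), h⟩) else 0

/-- The ideal of the `n(n-1)/2` equations of `CT_n` in `T_n × T_n`: it is generated by the entries
of `[X, Y]` strictly above the diagonal (the other entries vanish identically). -/
def commutatorIdeal (K : Type*) [Field K] (n : ℕ) : Ideal (UpperPairRing K n) :=
  Ideal.span {f | ∃ i j : Fin n, i < j ∧
    f = (genericX K n * genericY K n - genericY K n * genericX K n) i j}

/-- `CT_n` is a complete intersection: the ideal generated by its `n(n-1)/2` equations in the
polynomial ring of `T_n × T_n` has height (codimension) `n(n-1)/2`. -/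
def CTIsCompleteIntersection (K : Type*) [Field K] (n : ℕ) : Prop :=
  (commutatorIdeal K n).height = ((n * (n - 1) / 2 : ℕ) : ℕ∞)

end

/-! Suppose `(X, Y)` is in `CT K n` and `X` has two eigenvalues. The spectral idempotent `e` of one
of them is a polynomial in `X`; so it is upper triangular and commutes with `X` and `Y`. A
triangular conjugation carries `e` to a coordinate projection, and the pair becomes a sum of two
commuting pairs supported on complementary index sets of size at most `n - 1`. Each block ranges
over a copy of a smaller `CT`, which is irreducible because truncation maps `CT K (n - 1)` onto it.
In an irreducible set a nonempty open condition is dense, so both blocks can be perturbed until all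
eigenvalues are distinct. Hence the pair lies in the closure of `distinctCT`, which is contained in
`CT0` (`mem_closure_distinctCT_of_X_ne`; the case of `Y` follows by symmetry).

Thus `CT` is the union of the closed sets `CT0` and `constDiagCT`, and the latter is `NT` translated
by pairs of scalar matrices, of dimension `dim NT + 2`. A matrix with distinct eigenvalues, or a
regular matrix with a single eigenvalue, commutes only with polynomials in itself. So `CT0` is the
closure of the image of the affine space of pairs (triangular `X`, polynomial of degree below `n`):
it is irreducible, of dimension at most `n(n+1)/2 + n = n(n+3)/2`.

Against this stands Krull's height theorem: `n(n-1)/2` equations in `n(n+1)` variables leave every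
component with dimension at least `n(n+3)/2` (`le_topologicalKrullDim_upperPair_image`). If
`constDiagCT` has smaller dimension it contains no component, so `CT = CT0`; conversely it is a
proper closed subset of `CT`, so irreducibility makes its dimension drop. Likewise the commutator
ideal has full height exactly when no component exceeds `n(n+3)/2`, a condition that only
`constDiagCT` can violate. -/

noncomputable section

/-! ### Zariski topology, Nullstellensatz and polynomial maps -/

section Zariski

open TopologicalSpace Topology MvPolynomial

attribute [local instance] zariskiTopology

theorem Topology.IsInducing.isIrreducible_image_iff {A B : Type*} [TopologicalSpace A]
    [TopologicalSpace B] {f : A → B} (hf : IsInducing f) {s : Set A} :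
    IsIrreducible (f '' s) ↔ IsIrreducible s := by
  refine ⟨fun h => ⟨Set.image_nonempty.1 h.1, ?_⟩, fun h => h.image f hf.continuous.continuousOn⟩
  intro u v hu hv hsu hsv
  obtain ⟨U, hU, rfl⟩ := hf.isOpen_iff.1 hu
  obtain ⟨V, hV, rfl⟩ := hf.isOpen_iff.1 hv
  obtain ⟨x, hx, hxu⟩ := hsu
  obtain ⟨y, hy, hyv⟩ := hsv
  obtain ⟨_, ⟨z, hz, rfl⟩, hzu⟩ :=
    h.2 U V hU hV ⟨f x, ⟨x, hx, rfl⟩, hxu⟩ ⟨f y, ⟨y, hy, rfl⟩, hyv⟩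
  exact ⟨z, hz, hzu⟩

variable {K : Type*} [Field K] {σ τ : Type*}

theorem isClosed_zariski_iff {S : Set (σ → K)} :
    IsClosed S ↔ ∃ I : Ideal (MvPolynomial σ K), zeroLocus K I = S := by
  rw [← isOpen_compl_iff]
  change Sᶜᶜ ∈ _ ↔ _
  rw [compl_compl]
  rfl

theorem isClosed_zeroLocus (I : Ideal (MvPolynomial σ K)) : IsClosed (zeroLocus K I) :=
  isClosed_zariski_iff.2 ⟨I, rfl⟩

theorem zeroLocus_vanishingIdeal_of_isClosed {S : Set (σ → K)} (hS : IsClosed S) :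
    zeroLocus K (vanishingIdeal K S) = S := by
  obtain ⟨I, rfl⟩ := isClosed_zariski_iff.1 hS
  exact zeroLocus_vanishingIdeal_galoisConnection.l_u_l_eq_l I

theorem isClosed_setOf_eval_eq_zero (p : MvPolynomial σ K) : IsClosed {x | eval x p = 0} := by
  refine isClosed_zariski_iff.2 ⟨Ideal.span {p}, ?_⟩
  rw [zeroLocus_span]
  ext x
  simp [aeval_eq_eval]

theorem isPrime_vanishingIdeal_of_isIrreducible {S : Set (σ → K)} (hS : IsIrreducible S) :
    (vanishingIdeal K S).IsPrime := by
  constructor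
  · obtain ⟨x, hx⟩ := hS.1
    intro h
    have : (1 : MvPolynomial σ K) ∈ vanishingIdeal K S := h ▸ Submodule.mem_top
    simpa using this x hx
  · intro p q hpq
    have := isPreirreducible_iff_isClosed_union_isClosed.1 hS.2 _ _
      (isClosed_setOf_eval_eq_zero p) (isClosed_setOf_eval_eq_zero q) (fun x hx => by
        have := hpq x hx
        rw [map_mul, mul_eq_zero] at this
        exact this)
    exact this.imp (fun h x hx => h hx) (fun h x hx => h hx)

theorem isIrreducible_zeroLocus [IsAlgClosed K] [Finite σ] (P : Ideal (MvPolynomial σ K))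
    [P.IsPrime] : IsIrreducible (zeroLocus K P) := by
  constructor
  · by_contra h
    rw [Set.not_nonempty_iff_eq_empty] at h
    have := IsPrime.vanishingIdeal_zeroLocus (K := K) P
    rw [h, vanishingIdeal_empty] at this
    exact Ideal.IsPrime.ne_top' this.symm
  · rw [isPreirreducible_iff_isClosed_union_isClosed]
    intro A B hA hB hAB
    have h : vanishingIdeal K A * vanishingIdeal K B ≤ P := by
      conv_rhs => rw [← IsPrime.vanishingIdeal_zeroLocus (K := K) P]
      rw [Ideal.mul_le]
      intro p hp q hq x hx
      rw [map_mul, mul_eq_zero]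
      exact (hAB hx).imp (fun h => hp x h) (fun h => hq x h)
    refine (Ideal.IsPrime.mul_le ‹_›).1 h |>.imp ?_ ?_
    · intro h
      conv_rhs => rw [← zeroLocus_vanishingIdeal_of_isClosed hA]
      exact zeroLocus_anti_mono h
    · intro h
      conv_rhs => rw [← zeroLocus_vanishingIdeal_of_isClosed hB]
      exact zeroLocus_anti_mono h

/-- By the Nullstellensatz, irreducible closed subsets of the zero locus correspond to primes
containing `I`, with inclusions reversed; hence the order dual. Each direction of the correspondence
gives one inequality. `I` need not be radical. -/
theorem topologicalKrullDim_zeroLocus [IsAlgClosed K] [Finite σ] (I : Ideal (MvPolynomial σ K)) :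
    topologicalKrullDim (zeroLocus K I) = ringKrullDim (MvPolynomial σ K ⧸ I) := by
  rw [ringKrullDim_quotient, ← Order.krullDim_orderDual (α := PrimeSpectrum.zeroLocus _)]
  have hval : IsInducing (Subtype.val : zeroLocus K I → σ → K) := IsInducing.subtypeVal
  apply le_antisymm
  · refine Order.krullDim_le_of_strictMono (fun Z : IrreducibleCloseds (zeroLocus K I) =>
      OrderDual.toDual ⟨⟨vanishingIdeal K (Subtype.val '' (Z : Set (zeroLocus K I))),
        isPrime_vanishingIdeal_of_isIrreducible (hval.isIrreducible_image_iff.2 Z.isIrreducible)⟩,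
        ?_⟩) ?_
    · rintro p hp _ ⟨x, _, rfl⟩
      exact x.2 p hp
    · refine Monotone.strictMono_of_injective ?_ ?_
      · intro Z W h
        exact vanishingIdeal_anti_mono (Set.image_mono h)
      · intro Z W h
        have h' : vanishingIdeal K (Subtype.val '' (Z : Set (zeroLocus K I))) =
          vanishingIdeal K (Subtype.val '' (W : Set (zeroLocus K I))) :=
          congrArg (fun q => (OrderDual.ofDual q).1.asIdeal) h
        have hc : ∀ V : IrreducibleCloseds (zeroLocus K I),
            IsClosed (Subtype.val '' (V : Set (zeroLocus K I))) := fun V =>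
          (isClosed_zeroLocus I).isClosedEmbedding_subtypeVal.isClosedMap _ V.isClosed
        have := congrArg (zeroLocus K) h'
        rw [zeroLocus_vanishingIdeal_of_isClosed (hc Z),
          zeroLocus_vanishingIdeal_of_isClosed (hc W)] at this
        exact IrreducibleCloseds.ext (Subtype.val_injective.image_injective this)
  · have himg : ∀ P : Ideal (MvPolynomial σ K), I ≤ P →
        Subtype.val '' (Subtype.val ⁻¹' (zeroLocus K P) : Set (zeroLocus K I)) = zeroLocus K P := by
      intro P hP
      rw [Set.image_preimage_eq_iff, Subtype.range_coe]
      exact zeroLocus_anti_mono hP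
    refine Order.krullDim_le_of_strictMono
      (fun P : (PrimeSpectrum.zeroLocus (I : Set (MvPolynomial σ K)))ᵒᵈ =>
      (⟨Subtype.val ⁻¹' zeroLocus K (OrderDual.ofDual P).1.asIdeal, ?_, ?_⟩ :
        IrreducibleCloseds (zeroLocus K I))) ?_
    · rw [← hval.isIrreducible_image_iff, himg _ (OrderDual.ofDual P).2]
      exact isIrreducible_zeroLocus _
    · exact (isClosed_zeroLocus _).preimage continuous_subtype_val
    · refine Monotone.strictMono_of_injective ?_ ?_
      · intro P Q h
        exact fun x hx => zeroLocus_anti_mono (show (OrderDual.ofDual Q).1.asIdeal ≤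
          (OrderDual.ofDual P).1.asIdeal from h) hx
      · intro P Q h
        have h' : (Subtype.val ⁻¹' zeroLocus K (OrderDual.ofDual P).1.asIdeal :
          Set (zeroLocus K I)) = Subtype.val ⁻¹' zeroLocus K (OrderDual.ofDual Q).1.asIdeal :=
          congrArg (fun Z : IrreducibleCloseds (zeroLocus K I) => (Z : Set (zeroLocus K I))) h
        have := congrArg (fun s => vanishingIdeal K (Subtype.val '' s)) h'
        rw [himg _ (OrderDual.ofDual P).2, himg _ (OrderDual.ofDual Q).2,
          IsPrime.vanishingIdeal_zeroLocus, IsPrime.vanishingIdeal_zeroLocus] at this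
        exact OrderDual.ofDual.injective (Subtype.ext (PrimeSpectrum.ext this))

theorem topologicalKrullDim_of_isClosed [IsAlgClosed K] [Finite σ] {S : Set (σ → K)}
    (hS : IsClosed S) :
    topologicalKrullDim S = ringKrullDim (MvPolynomial σ K ⧸ vanishingIdeal K S) := by
  rw [← topologicalKrullDim_zeroLocus, zeroLocus_vanishingIdeal_of_isClosed hS]

/-- The functions on `A` that are polynomials in the coordinates `c`. -/
def regularFunctions {A : Type*} (c : A → σ → K) : Subalgebra K (A → K) :=
  (AlgHom.pi (fun a : A => aeval (R := K) (c a))).range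

theorem mem_regularFunctions {A : Type*} {c : A → σ → K} {f : A → K} :
    f ∈ regularFunctions c ↔ ∃ p : MvPolynomial σ K, ∀ a, f a = eval (c a) p := by
  rw [regularFunctions, AlgHom.mem_range]
  refine exists_congr fun p => ?_
  rw [funext_iff]
  refine forall_congr' fun a => ?_
  rw [eq_comm, AlgHom.pi_apply, aeval_eq_eval]

theorem coord_mem_regularFunctions {A : Type*} (c : A → σ → K) (s : σ) :
    (fun a => c a s) ∈ regularFunctions c :=
  mem_regularFunctions.2 ⟨X s, fun a => by simp⟩

theorem const_mem_regularFunctions {A : Type*} (c : A → σ → K) (r : K) :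
    (fun _ => r) ∈ regularFunctions c :=
  mem_regularFunctions.2 ⟨C r, fun a => by simp⟩

theorem neg_mem_regularFunctions {A : Type*} {c : A → σ → K} {f : A → K}
    (hf : f ∈ regularFunctions c) : (fun a => -f a) ∈ regularFunctions c := by
  obtain ⟨p, hp⟩ := mem_regularFunctions.1 hf
  exact mem_regularFunctions.2 ⟨-p, fun a => by rw [hp, map_neg]⟩

variable {A B : Type*} [TopologicalSpace A] [TopologicalSpace B]

theorem isClosed_setOf_eq_zero_of_regular {c : A → σ → K} (hc : IsInducing c) {f : A → K}
    (hf : f ∈ regularFunctions c) : IsClosed {a | f a = 0} := by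
  obtain ⟨p, hp⟩ := mem_regularFunctions.1 hf
  simp_rw [hp]
  exact (isClosed_setOf_eval_eq_zero p).preimage hc.continuous

/-- The preimage of the zeros of `q` is the zero set of `q` with the defining polynomials of the map
substituted into it. -/
theorem continuous_of_regular {c : A → σ → K} {d : B → τ → K} (hc : IsInducing c)
    (hd : IsInducing d) {f : A → B} (h : ∀ t, (fun a => d (f a) t) ∈ regularFunctions c) :
    Continuous f := by
  rw [hd.continuous_iff, continuous_iff_isClosed]
  intro S hS
  obtain ⟨I, rfl⟩ := isClosed_zariski_iff.1 hS
  choose p hp using fun t => mem_regularFunctions.1 (h t)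
  have : d ∘ f ⁻¹' zeroLocus K I = ⋂ q ∈ I, {a | eval (c a) (bind₁ p q) = 0} := by
    ext a
    simp only [Set.mem_preimage, mem_zeroLocus_iff, Set.mem_iInter, Set.mem_ofPred_eq, aeval_eq_eval]
    refine forall₂_congr fun q _ => ?_
    have : eval (c a) (bind₁ p q) = eval ((d ∘ f) a) q := by
      rw [← aeval_eq_eval, aeval_bind₁]
      simp only [aeval_eq_eval, ← hp]
      rfl
    rw [this]
  rw [this]
  exact isClosed_biInter fun q _ => isClosed_setOf_eq_zero_of_regular hc
    (mem_regularFunctions.2 ⟨_, fun _ => rfl⟩)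

theorem isIrreducible_univ_affineSpace [IsAlgClosed K] [Finite σ] :
    IsIrreducible (Set.univ : Set (σ → K)) := by
  have := isIrreducible_zeroLocus (⊥ : Ideal (MvPolynomial σ K))
  rwa [zeroLocus_bot] at this

end Zariski

/-! ### Heights and dimensions in polynomial rings over a field -/

section Dimension

open MvPolynomial Algebra

theorem Polynomial.exists_isMaximal_height_eq {R : Type*} [CommRing R] [IsNoetherianRing R]
    [IsJacobsonRing R] (M : Ideal (Polynomial R)) [M.IsMaximal] :
    ∃ p : Ideal R, p.IsMaximal ∧ M.height = p.height + 1 :=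
  ⟨M.under R, Polynomial.isMaximal_comap_C_of_isJacobsonRing M,
    Polynomial.height_eq_height_add_one (M.under R) M⟩

/-- Adjoining one variable to a Noetherian Jacobson ring raises the height of a maximal ideal by
exactly one over its contraction, which is again maximal. Equality of all these heights lets
dimension be computed at any closed point. -/
theorem MvPolynomial.height_of_isMaximal {K : Type*} [Field K] {σ : Type*} [Finite σ]
    (m : Ideal (MvPolynomial σ K)) [hm : m.IsMaximal] : m.height = Nat.card σ := by
  induction σ using Finite.induction_empty_option with
  | of_equiv e H =>
    let e' := (renameEquiv K e).symm.toRingEquiv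
    have : (m.map e').IsMaximal := Ideal.map_isMaximal_of_equiv e'
    have h := H (m.map e')
    rwa [e'.height_map, Nat.card_congr e] at h
  | h_empty =>
    have h : m.height ≤ ringKrullDim (MvPolynomial PEmpty K) :=
      Ideal.height_le_ringKrullDim_of_ne_top hm.ne_top
    rw [ringKrullDim_of_isNoetherianRing, ringKrullDim_eq_zero_of_field] at h
    simp at h
    simp [h]
  | @h_option ι _ IH =>
    let e' := (MvPolynomial.optionEquivLeft K ι).toRingEquiv
    have hmax : (m.map e').IsMaximal := Ideal.map_isMaximal_of_equiv e'
    obtain ⟨p, hp, h⟩ := Polynomial.exists_isMaximal_height_eq (m.map e')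
    rw [e'.height_map, IH] at h
    rw [h]
    simp

/-- This finds a closed point lying on the component `P` and on no other. The finite intersection of
the other minimal primes is not inside `P`; in a Jacobson ring an element `f` of it outside `P` is
avoided by some maximal ideal above `P`. -/
theorem Ideal.exists_isMaximal_forall_minimalPrimes {R : Type*} [CommRing R] [IsNoetherianRing R]
    [IsJacobsonRing R] {J P : Ideal R} (hP : P ∈ J.minimalPrimes) :
    ∃ m : Ideal R, m.IsMaximal ∧ P ≤ m ∧ ∀ Q ∈ J.minimalPrimes, Q ≤ m → Q = P := by
  classical
  have hfin := Ideal.finite_minimalPrimes_of_isNoetherianRing R J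
  have hPp : P.IsPrime := hP.1.1
  let s := hfin.toFinset.erase P
  have hs : ¬ (s.inf id ≤ P) := by
    intro h
    obtain ⟨Q, hQ, hQP⟩ := (Ideal.IsPrime.inf_le' hPp).1 h
    have hQ' : Q ∈ J.minimalPrimes := hfin.mem_toFinset.1 (Finset.mem_of_mem_erase hQ)
    exact Finset.ne_of_mem_erase hQ (le_antisymm hQP (hP.2 hQ'.1 hQP))
  obtain ⟨f, hf, hfP⟩ := Set.not_subset.1 hs
  have hjac : P.jacobson = P := IsJacobsonRing.out ‹_› hPp.isRadical
  rw [SetLike.mem_coe, ← hjac, Ideal.jacobson, Submodule.mem_sInf] at hfP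
  push Not at hfP
  obtain ⟨m, ⟨hPm, hm⟩, hfm⟩ := hfP
  refine ⟨m, hm, hPm, fun Q hQ hQm => ?_⟩
  by_contra hne
  have hQs : Q ∈ s := Finset.mem_erase.2 ⟨hne, hfin.mem_toFinset.2 hQ⟩
  exact hfm (hQm ((Finset.inf_le hQs : s.inf id ≤ Q) hf))

/-- Every prime between `J` and `m` contains a minimal prime of `J`, which can only be `P`. So
chains of primes below `m` in `R ⧸ J` are chains in `R ⧸ P`. -/
theorem Ideal.height_map_quotientMk_le {R : Type*} [CommRing R] {J P m : Ideal R} [m.IsPrime]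
    (hJm : J ≤ m) (h : ∀ Q ∈ J.minimalPrimes, Q ≤ m → Q = P) :
    ((m.map (Ideal.Quotient.mk J)).height : WithBot ℕ∞) ≤ ringKrullDim (R ⧸ P) := by
  have : (m.map (Ideal.Quotient.mk J)).IsPrime := Ideal.isPrime_map_quotientMk_of_isPrime hJm
  let q : PrimeSpectrum (R ⧸ J) := ⟨m.map (Ideal.Quotient.mk J), this⟩
  have hq : q.asIdeal.comap (Ideal.Quotient.mk J) = m := by
    simp only [q]
    rw [Ideal.comap_map_of_surjective _ Ideal.Quotient.mk_surjective, ← RingHom.ker_eq_comap_bot,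
      Ideal.mk_ker, sup_eq_left.2 hJm]
  change (q.asIdeal.height : WithBot ℕ∞) ≤ _
  rw [PrimeSpectrum.height_eq_orderHeight, Order.height_eq_krullDim_Iic, ringKrullDim_quotient]
  refine Order.krullDim_le_of_strictMono (fun p : Set.Iic q =>
    ⟨⟨p.1.asIdeal.comap (Ideal.Quotient.mk J), inferInstance⟩, ?_⟩) ?_
  · have hJ : J ≤ p.1.asIdeal.comap (Ideal.Quotient.mk J) := by
      conv_lhs => rw [← Ideal.mk_ker (I := J)]
      exact Ideal.comap_mono bot_le
    obtain ⟨Q, hQ, hQp⟩ := Ideal.exists_minimalPrimes_le hJ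
    have hle : p.1.asIdeal.comap (Ideal.Quotient.mk J) ≤ m := by
      rw [← hq]
      exact Ideal.comap_mono p.2
    obtain rfl := h Q hQ (hQp.trans hle)
    exact hQp
  · refine Monotone.strictMono_of_injective (fun p p' hp => Ideal.comap_mono hp) ?_
    intro p p' hp
    have hp' : p.1.asIdeal.comap (Ideal.Quotient.mk J) = p'.1.asIdeal.comap (Ideal.Quotient.mk J) :=
      congrArg (fun z => z.1.asIdeal) hp
    exact Subtype.ext (PrimeSpectrum.ext
      (Ideal.comap_injective_of_surjective _ Ideal.Quotient.mk_surjective hp'))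

variable {K : Type*} [Field K] {σ : Type*} [Finite σ]

/-- Krull's height theorem at a closed point lying on `P` alone: the height of `m`, which is the
number of variables, drops by at most the number of generators of `J` on passing to the quotient. -/
theorem card_le_ringKrullDim_quotient_add_spanFinrank {J P : Ideal (MvPolynomial σ K)}
    (hP : P ∈ J.minimalPrimes) :
    (Nat.card σ : WithBot ℕ∞) ≤ ringKrullDim (MvPolynomial σ K ⧸ P) + J.spanFinrank := by
  obtain ⟨m, hm, hPm, hQ⟩ := Ideal.exists_isMaximal_forall_minimalPrimes hP
  have hJm : J ≤ m := hP.1.2.trans hPm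
  have h₁ := Ideal.height_le_height_add_spanFinrank_of_le hJm
  have h₂ := Ideal.height_map_quotientMk_le hJm hQ
  rw [MvPolynomial.height_of_isMaximal] at h₁
  calc (Nat.card σ : WithBot ℕ∞) = (((Nat.card σ : ℕ∞)) : WithBot ℕ∞) := rfl
    _ ≤ (((m.map (Ideal.Quotient.mk J)).height + J.spanFinrank : ℕ∞) : WithBot ℕ∞) :=
      WithBot.coe_le_coe.2 h₁
    _ = ((m.map (Ideal.Quotient.mk J)).height : WithBot ℕ∞) + J.spanFinrank := rfl
    _ ≤ _ := by gcongr

/-- A prime of height `h` in a Noetherian ring is minimal over an ideal with `h` generators, so the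
bound for that ideal applies. -/
theorem card_le_ringKrullDim_quotient_add_height (P : Ideal (MvPolynomial σ K)) [hP : P.IsPrime] :
    (Nat.card σ : WithBot ℕ∞) ≤ ringKrullDim (MvPolynomial σ K ⧸ P) + P.height := by
  obtain ⟨s, hs, hcard⟩ := P.exists_finset_card_eq_height_of_isNoetherianRing
  refine (card_le_ringKrullDim_quotient_add_spanFinrank hs).trans ?_
  rw [← hcard]
  gcongr
  have := Submodule.spanFinrank_span_le_ncard_of_finite (R := MvPolynomial σ K) s.finite_toSet
  rw [Set.ncard_coe_finset] at this
  exact_mod_cast this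

/-- A chain below a prime `p` containing `I` can be joined to a chain above it. -/
theorem height_add_ringKrullDim_quotient_le {R : Type*} [CommRing R] (I : Ideal R) (hI : I ≠ ⊤) :
    (I.height : WithBot ℕ∞) + ringKrullDim (R ⧸ I) ≤ ringKrullDim R := by
  have : Nonempty (PrimeSpectrum.zeroLocus (R := R) I) := by
    rwa [Set.nonempty_coe_sort, Set.nonempty_iff_ne_empty, ne_eq,
      PrimeSpectrum.zeroLocus_empty_iff_eq_top]
  have : Nonempty (PrimeSpectrum R) := this.map Subtype.val
  rw [ringKrullDim_quotient, ringKrullDim, Order.krullDim_eq_iSup_coheight_of_nonempty,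
    Order.krullDim_eq_iSup_height_add_coheight_of_nonempty, ← WithBot.coe_add,
    WithBot.coe_le_coe, ENat.add_iSup]
  refine iSup_le fun p => ?_
  refine le_iSup_of_le p.1 (add_le_add ?_ ?_)
  · rw [← PrimeSpectrum.height_eq_orderHeight]
    exact Ideal.height_mono p.2
  · exact Order.coheight_le_coheight_apply_of_strictMono Subtype.val (fun _ _ h => h) p

/-- Noether normalization makes `A` finite over a polynomial ring in `s` variables. Transcendence
degree bounds `s` by the number of variables of the target, and incomparability in integral
extensions bounds the dimension of `A` by `s`. -/
theorem ringKrullDim_le_card_of_injective {τ : Type} [Finite τ] {A : Type*} [CommRing A]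
    [Algebra K A] [Algebra.FiniteType K A] [Nontrivial A] (f : A →ₐ[K] MvPolynomial τ K)
    (hf : Function.Injective f) : ringKrullDim A ≤ Nat.card τ := by
  obtain ⟨s, g, hg, hfin⟩ := exists_finite_inj_algHom_of_fg K A
  have hs : s ≤ Nat.card τ := by
    have h := trdeg_le_of_injective (f.comp g) (hf.comp hg)
    rw [MvPolynomial.trdeg_of_isDomain, MvPolynomial.trdeg_of_isDomain, Cardinal.lift_le] at h
    have := Cardinal.toNat_le_toNat h (Cardinal.lt_aleph0_of_finite τ)
    simpa [Nat.card] using this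
  have hdim : ringKrullDim A ≤ ringKrullDim (MvPolynomial (Fin s) K) := by
    algebraize [g.toRingHom]
    have : Algebra.IsIntegral (MvPolynomial (Fin s) K) A := by
      have : Module.Finite (MvPolynomial (Fin s) K) A := hfin
      infer_instance
    refine Order.krullDim_le_of_strictMono
      (PrimeSpectrum.comap (algebraMap (MvPolynomial (Fin s) K) A)) ?_
    intro p q hpq
    exact Ideal.IsIntegral.comap_lt_comap hpq
  refine hdim.trans ?_
  rw [ringKrullDim_of_isNoetherianRing, ringKrullDim_eq_zero_of_field]
  simpa using hs

end Dimension

/-! ### Dimension of closed subsets of affine space -/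

section ZariskiDimension

open TopologicalSpace Topology MvPolynomial

attribute [local instance] zariskiTopology

variable {K : Type*} [Field K] [IsAlgClosed K]

/-- A function vanishing on `T` but not on `S` is a nonzerodivisor in the coordinate ring of `S`,
which is a domain; killing it lowers the dimension. -/
theorem topologicalKrullDim_add_one_le_of_ssubset {σ : Type*} [Finite σ] {S T : Set (σ → K)}
    (hS : IsClosed S) (hSirr : IsIrreducible S) (hT : IsClosed T) (hTS : T ⊂ S) :
    topologicalKrullDim T + 1 ≤ topologicalKrullDim S := by
  rw [topologicalKrullDim_of_isClosed hS, topologicalKrullDim_of_isClosed hT]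
  have hle : vanishingIdeal K S ≤ vanishingIdeal K T := vanishingIdeal_anti_mono hTS.1
  have := isPrime_vanishingIdeal_of_isIrreducible hSirr
  obtain ⟨r, hr, hrS⟩ : ∃ r ∈ vanishingIdeal K T, r ∉ vanishingIdeal K S := by
    by_contra! h
    refine hTS.2 ?_
    rw [← zeroLocus_vanishingIdeal_of_isClosed hS, ← zeroLocus_vanishingIdeal_of_isClosed hT]
    exact zeroLocus_anti_mono h
  refine ringKrullDim_succ_le_of_surjective (Ideal.Quotient.factor hle)
    (Ideal.Quotient.factor_surjective hle) (r := Ideal.Quotient.mk _ r) ?_ ?_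
  · rw [mem_nonZeroDivisors_iff_ne_zero, ne_eq, Ideal.Quotient.eq_zero_iff_mem]
    exact hrS
  · rw [Ideal.Quotient.factor_mk, Ideal.Quotient.eq_zero_iff_mem]
    exact hr

/-- The functions vanishing on the closure of the image form the kernel of the comorphism, so its
coordinate ring embeds in the polynomial ring of the parameters. -/
theorem topologicalKrullDim_closure_range_le {σ : Type*} [Finite σ] {τ : Type} [Finite τ]
    {f : (τ → K) → σ → K}
    (hf : ∀ s, (fun x => f x s) ∈ regularFunctions (σ := τ) (id : (τ → K) → τ → K)) :
    topologicalKrullDim (closure (Set.range f)) ≤ Nat.card τ := by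
  choose p hp using fun s => mem_regularFunctions.1 (hf s)
  rw [topologicalKrullDim_of_isClosed isClosed_closure]
  have hker : vanishingIdeal K (closure (Set.range f)) =
      RingHom.ker (aeval (R := K) p : MvPolynomial σ K →ₐ[K] MvPolynomial τ K) := by
    have hev : ∀ q x, eval x (aeval p q) = eval (f x) q := by
      intro q x
      have h := comp_aeval_apply (R := K) p (aeval x : MvPolynomial τ K →ₐ[K] K) q
      simp only [aeval_eq_eval] at h
      have hfx : f x = fun s => eval x (p s) := funext fun s => hp s x
      rw [hfx]
      exact h
    ext q
    rw [RingHom.mem_ker]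
    constructor
    · intro hq
      apply MvPolynomial.funext
      intro x
      rw [map_zero]
      refine (hev q x).trans ?_
      exact hq _ (subset_closure ⟨x, rfl⟩)
    · intro hq x hx
      have : closure (Set.range f) ⊆ {y | eval y q = 0} := by
        refine closure_minimal ?_ (isClosed_setOf_eval_eq_zero q)
        rintro _ ⟨y, rfl⟩
        refine (hev q y).symm.trans ?_
        rw [show aeval p q = 0 from hq, map_zero]
      exact this hx
  rw [hker]
  have : Nontrivial (MvPolynomial σ K ⧸
      RingHom.ker (aeval (R := K) p : MvPolynomial σ K →ₐ[K] MvPolynomial τ K)) :=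
    Ideal.Quotient.nontrivial_iff.2 (RingHom.ker_ne_top _)
  exact ringKrullDim_le_card_of_injective
    (Ideal.kerLiftAlg (aeval (R := K) p : MvPolynomial σ K →ₐ[K] MvPolynomial τ K))
    (Ideal.kerLiftAlg_injective _)

/-- The set is a product with an affine space; its coordinate ring is a polynomial ring over the
Noetherian ring of `S`. -/
theorem topologicalKrullDim_preimage_comp_inr {σ ι : Type*} [Finite σ] [Finite ι]
    {S : Set (σ → K)} (hS : IsClosed S) :
    topologicalKrullDim {x : ι ⊕ σ → K | x ∘ Sum.inr ∈ S} =
      topologicalKrullDim S + (Nat.card ι : ℕ) := by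
  obtain ⟨I, rfl⟩ := isClosed_zariski_iff.1 hS
  have hset : {x : ι ⊕ σ → K | x ∘ Sum.inr ∈ zeroLocus K I} =
      zeroLocus K (I.map (rename (R := K) (Sum.inr : σ → ι ⊕ σ))) := by
    rw [Ideal.map, zeroLocus_span]
    ext x
    simp only [Set.mem_ofPred_eq, mem_zeroLocus_iff, Set.forall_mem_image, SetLike.mem_coe]
    refine forall₂_congr fun p _ => ?_
    rw [aeval_rename]
  rw [hset, topologicalKrullDim_zeroLocus, topologicalKrullDim_zeroLocus]
  let e := (sumAlgEquiv K ι σ).toRingEquiv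
  have he : I.map (C : _ →+* MvPolynomial ι (MvPolynomial σ K)) =
      (I.map (rename (R := K) (Sum.inr : σ → ι ⊕ σ))).map (e : _ →+* _) := by
    rw [← Ideal.map_coe (rename (R := K) (Sum.inr : σ → ι ⊕ σ)), Ideal.map_map]
    congr 1
    apply MvPolynomial.ringHom_ext
    · intro r
      simp [e]
    · intro i
      simp [e]
  have e' : (MvPolynomial (ι ⊕ σ) K ⧸ I.map (rename (R := K) (Sum.inr : σ → ι ⊕ σ))) ≃+*
      (MvPolynomial ι (MvPolynomial σ K) ⧸ I.map (C : _ →+* MvPolynomial ι (MvPolynomial σ K))) :=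
    Ideal.quotientEquiv _ _ e he
  rw [ringKrullDim_eq_of_ringEquiv (S := MvPolynomial ι (MvPolynomial σ K) ⧸
    I.map (C : _ →+* MvPolynomial ι (MvPolynomial σ K))) e',
    ← ringKrullDim_eq_of_ringEquiv (quotientEquivQuotientMvPolynomial (σ := ι) I).toRingEquiv,
    ringKrullDim_of_isNoetherianRing]

end ZariskiDimension

/-! ### Triangular matrices, their centralizers and spectral idempotents -/

theorem Commute.polynomial_aeval_right {R S : Type*} [CommRing R] [Ring S] [Algebra R S] {a b : S}
    (h : Commute b a) (q : Polynomial R) : Commute b (Polynomial.aeval a q) := by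
  induction q using Polynomial.induction_on' with
  | add p q hp hq => rw [map_add]; exact hp.add_right hq
  | monomial k r =>
    rw [Polynomial.aeval_monomial]
    exact Commute.mul_right (Algebra.commutes r b).symm (h.pow_right k)

namespace Matrix.BlockTriangular

open Polynomial

variable {K : Type*} [Field K] {n : ℕ} {A B : Matrix (Fin n) (Fin n) K}

theorem mul_apply_self (hA : A.BlockTriangular id) (hB : B.BlockTriangular id) (i : Fin n) :
    (A * B) i i = A i i * B i i := by
  rw [Matrix.mul_apply, Finset.sum_eq_single i]
  · intro k _ hk
    rcases lt_or_gt_of_ne hk with h | h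
    · rw [hA h, zero_mul]
    · rw [hB h, mul_zero]
  · simp

theorem polynomial_aeval (hA : A.BlockTriangular id) (p : K[X]) :
    (aeval A p).BlockTriangular id := by
  have hmem : A ∈ Matrix.blockTriangularSubalgebra (R := K) (A := K) (id : Fin n → Fin n) := hA
  exact Algebra.adjoin_le (Set.singleton_subset_iff.2 hmem) (aeval_mem_adjoin_singleton K A)

theorem polynomial_aeval_apply_self (hA : A.BlockTriangular id) (p : K[X]) (i : Fin n) :
    (aeval A p) i i = p.eval (A i i) := by
  induction p using Polynomial.induction_on' with
  | add p q hp hq => simp [hp, hq]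
  | monomial k a =>
    rw [aeval_monomial, eval_monomial, ← Algebra.smul_def, Matrix.smul_apply, smul_eq_mul]
    congr 1
    induction k with
    | zero => simp
    | succ k ih => rw [pow_succ, mul_apply_self (hA.pow k) hA, ih, pow_succ]

/-- Each diagonal entry is a root of the minimal polynomial, and the characteristic polynomial
bounds its degree from above. -/
theorem natDegree_minpoly_of_injective_diag (hA : A.BlockTriangular id)
    (hd : Function.Injective A.diag) : (minpoly K A).natDegree = n := by
  apply le_antisymm
  · have h := Polynomial.natDegree_le_of_dvd (Matrix.minpoly_dvd_charpoly A)
      A.charpoly_monic.ne_zero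
    simpa [Matrix.charpoly_natDegree_eq_dim] using h
  · have h0 : minpoly K A ≠ 0 := minpoly.ne_zero (Algebra.IsIntegral.isIntegral A)
    classical
    have hsub : (Finset.univ.image A.diag).val ⊆ (minpoly K A).roots := by
      intro x hx
      have hx' : x ∈ Finset.univ.image A.diag := hx
      obtain ⟨i, -, rfl⟩ := Finset.mem_image.1 hx'
      rw [mem_roots h0, IsRoot.def, Matrix.diag_apply, ← polynomial_aeval_apply_self hA,
        minpoly.aeval, Matrix.zero_apply]
    have h := Polynomial.card_le_degree_of_subset_roots hsub
    simpa [Finset.card_image_of_injective _ hd] using h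

theorem spectrum_eq_range_diag (hA : A.BlockTriangular id) :
    spectrum K A = Set.range A.diag := by
  ext x
  rw [Matrix.mem_spectrum_iff_isRoot_charpoly, Matrix.charpoly_of_isUpperTriangular A hA, IsRoot.def,
    eval_prod, Finset.prod_eq_zero_iff]
  simp [sub_eq_zero, eq_comm]

theorem nontrivial_spectrum_iff (hA : A.BlockTriangular id) :
    (spectrum K A).Nontrivial ↔ ∃ i j, A i i ≠ A j j := by
  rw [hA.spectrum_eq_range_diag]
  constructor
  · rintro ⟨_, ⟨i, rfl⟩, _, ⟨j, rfl⟩, h⟩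
    exact ⟨i, j, h⟩
  · rintro ⟨i, j, h⟩
    exact ⟨_, ⟨i, rfl⟩, _, ⟨j, rfl⟩, h⟩

theorem exists_spectrum_eq_singleton (hA : A.BlockTriangular id) (hn : n ≠ 0)
    (h : ∀ i j, A i i = A j j) :
    ∃ x, spectrum K A = {x} := by
  have : NeZero n := ⟨hn⟩
  refine ⟨A 0 0, ?_⟩
  rw [hA.spectrum_eq_range_diag, show A.diag = fun _ => A 0 0 from funext fun i => h i 0,
    Set.range_const]

/-- Induction on the distance from the diagonal: once the nearer entries of `B` vanish, the `(i, j)`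
entry of `A * B = B * A` reads `(A i i - A j j) * B i j = 0`. -/
theorem eq_zero_of_commute (hA : A.BlockTriangular id) (hd : Function.Injective A.diag)
    (hB : B.BlockTriangular id) (hB0 : ∀ i, B i i = 0) (hAB : A * B = B * A) : B = 0 := by
  -- The subtraction is truncated, so positions on and below the diagonal all count as distance `0`.
  have key : ∀ m : ℕ, ∀ i j : Fin n, (j : ℕ) - i = m → B i j = 0 := by
    intro m
    induction m using Nat.strong_induction_on with
    | _ m ih =>
      intro i j hm
      rcases lt_trichotomy i j with hij | rfl | hij
      · have h := congrFun (congrFun hAB i) j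
        rw [Matrix.mul_apply, Matrix.mul_apply, Finset.sum_eq_single i, Finset.sum_eq_single j] at h
        · have h' : (A i i - A j j) * B i j = 0 := by rw [sub_mul, h]; ring
          refine (mul_eq_zero.1 h').resolve_left (sub_ne_zero.2 fun h'' => ?_)
          exact hij.ne (hd h'')
        · intro k _ hk
          rcases lt_or_gt_of_ne hk with h | h
          · rw [ih ((k : ℕ) - i) (by omega) i k rfl, zero_mul]
          · rw [hA h, mul_zero]
        · simp
        · intro k _ hk
          rcases lt_or_gt_of_ne hk with h | h
          · rw [hA h, zero_mul]
          · rw [ih ((j : ℕ) - k) (by omega) k j rfl, mul_zero]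
        · simp
      · exact hB0 i
      · exact hB hij
  ext i j
  exact key _ i j rfl

/-- Lagrange interpolation matches the diagonals; the difference from `B` is then strictly
triangular and commutes with `A`, hence is zero. -/
theorem exists_aeval_eq_of_injective_diag (hA : A.BlockTriangular id)
    (hd : Function.Injective A.diag) (hB : B.BlockTriangular id) (hAB : A * B = B * A) :
    ∃ p : K[X], B = aeval A p := by
  refine ⟨Lagrange.interpolate Finset.univ A.diag B.diag, ?_⟩
  set p := Lagrange.interpolate Finset.univ A.diag B.diag
  rw [← sub_eq_zero]
  refine eq_zero_of_commute hA hd (hB.sub (polynomial_aeval hA p)) (fun i => ?_) ?_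
  · rw [Matrix.sub_apply, polynomial_aeval_apply_self hA, sub_eq_zero]
    exact (Lagrange.eval_interpolate_at_node B.diag hd.injOn (Finset.mem_univ i)).symm
  · have : Commute A (aeval A p) := (Commute.refl A).polynomial_aeval_right p
    rw [mul_sub, sub_mul, hAB, this.eq]

end Matrix.BlockTriangular

/-- A matrix commuting with `A` is determined by its value at a cyclic vector `v`, and `B v` has the
form `p(A) v`. -/
theorem Matrix.exists_aeval_eq_of_cyclic {K : Type*} [Field K] {n : ℕ}
    {A B : Matrix (Fin n) (Fin n) K} (hAB : A * B = B * A) (v : Fin n → K)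
    (hv : ∀ u, ∃ p : Polynomial K, Matrix.mulVec (Polynomial.aeval A p) v = u) :
    ∃ p : Polynomial K, B = Polynomial.aeval A p := by
  obtain ⟨p, hp⟩ := hv (B.mulVec v)
  refine ⟨p, ?_⟩
  have hcomm : ∀ q : Polynomial K, B * Polynomial.aeval A q = Polynomial.aeval A q * B := fun q =>
    (show Commute B A from hAB.symm).polynomial_aeval_right q
  apply Matrix.toLin'.injective
  apply LinearMap.ext
  intro u
  obtain ⟨q, rfl⟩ := hv u
  rw [Matrix.toLin'_apply, Matrix.toLin'_apply, Matrix.mulVec_mulVec, Matrix.mulVec_mulVec, hcomm,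
    ← Matrix.mulVec_mulVec, ← hp, Matrix.mulVec_mulVec, ← map_mul, mul_comm, map_mul]

namespace Matrix.BlockTriangular

open Polynomial

variable {K : Type*} [Field K] {n : ℕ} {A B : Matrix (Fin n) (Fin n) K}

theorem aeval_X_sub_C_pow_eq_zero (hA : A.BlockTriangular id) {x : K} (hx : ∀ i, A i i = x) :
    aeval A ((X - C x) ^ n) = 0 := by
  have h := Matrix.aeval_self_charpoly A
  rw [Matrix.charpoly_of_isUpperTriangular A hA] at h
  simpa [hx] using h

/-- Regularity gives `v` with `(A - x)^(n-1) v ≠ 0`. Then `p ↦ p(A) v` is injective on polynomials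
of degree below `n`, and equality of dimensions makes it surjective. -/
theorem exists_cyclic_of_natDegree_minpoly (hA : A.BlockTriangular id) (hn : 0 < n) {x : K}
    (hx : ∀ i, A i i = x) (hreg : (minpoly K A).natDegree = n) :
    ∃ v : Fin n → K, ∀ u, ∃ p : K[X], (aeval A p).mulVec v = u := by
  have hne : aeval A ((X - C x) ^ (n - 1)) ≠ 0 := by
    intro h
    have := natDegree_le_of_dvd (minpoly.dvd K A h) (pow_ne_zero _ (X_sub_C_ne_zero x))
    rw [hreg, natDegree_pow, natDegree_X_sub_C] at this
    omega
  obtain ⟨v, hv⟩ : ∃ v : Fin n → K, (aeval A ((X - C x) ^ (n - 1))).mulVec v ≠ 0 := by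
    by_contra! h
    exact hne (Matrix.toLin'.injective (LinearMap.ext fun v => by
      rw [Matrix.toLin'_apply, h]; simp))
  refine ⟨v, fun u => ?_⟩
  let φ : degreeLT K n →ₗ[K] (Fin n → K) :=
    (LinearMap.applyₗ v ∘ₗ (Matrix.toLin' : Matrix (Fin n) (Fin n) K ≃ₗ[K] _).toLinearMap ∘ₗ
      (aeval A).toLinearMap).comp (degreeLT K n).subtype
  have hφ : ∀ p, φ p = (aeval A (p : K[X])).mulVec v := fun p => rfl
  have hinj : Function.Injective φ := by
    rw [injective_iff_map_eq_zero]
    rintro ⟨p, hp⟩ h0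
    rw [hφ] at h0
    by_contra hp0
    have hp0' : p ≠ 0 := fun h => hp0 (Subtype.ext h)
    obtain ⟨q, hq, hndvd⟩ := exists_eq_pow_rootMultiplicity_mul_and_not_dvd p hp0' x
    set j := p.rootMultiplicity x
    have hj : j ≤ n - 1 := by
      have h1 : j ≤ p.natDegree := by
        have := natDegree_le_of_dvd (pow_rootMultiplicity_dvd p x) hp0'
        rwa [natDegree_pow, natDegree_X_sub_C, mul_one] at this
      have h2 := (natDegree_lt_iff_degree_lt hp0').2 (mem_degreeLT.1 hp)
      omega
    have hcop : IsCoprime ((X - C x) ^ n) q :=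
      ((irreducible_X_sub_C x).coprime_iff_not_dvd.2 hndvd).pow_left
    obtain ⟨a, b, hab⟩ := hcop
    apply hv
    -- As `p = (X - x)^j q` with `j ≤ n - 1` and `q` prime to `X - x`, Bézout puts `(X - x)^(n-1)`
    -- in the ideal of `(X - x)^n` and `p`. Both kill `v`, contradicting its choice.
    have hexp : (X - C x) ^ (n - 1) =
        ((X - C x) ^ (n - 1) * a) * (X - C x) ^ n + ((X - C x) ^ (n - 1 - j) * b) * p := by
      calc (X - C x) ^ (n - 1) = (X - C x) ^ (n - 1) * (a * (X - C x) ^ n + b * q) := by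
            rw [hab, mul_one]
        _ = ((X - C x) ^ (n - 1) * a) * (X - C x) ^ n +
            ((X - C x) ^ (n - 1 - j) * b) * ((X - C x) ^ j * q) := by
            rw [show (X - C x) ^ (n - 1) = (X - C x) ^ (n - 1 - j) * (X - C x) ^ j by
              rw [← pow_add, Nat.sub_add_cancel hj]]
            ring
        _ = _ := by rw [← hq]
    rw [hexp, map_add, map_mul, map_mul _ _ p, aeval_X_sub_C_pow_eq_zero hA hx, mul_zero, zero_add,
      ← Matrix.mulVec_mulVec, h0, Matrix.mulVec_zero]
  have hfin : Module.finrank K (degreeLT K n) = Module.finrank K (Fin n → K) := by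
    rw [(degreeLTEquiv K n).finrank_eq]
  have : FiniteDimensional K (degreeLT K n) := (degreeLTEquiv K n).symm.finiteDimensional
  obtain ⟨p, hp⟩ := (LinearMap.injective_iff_surjective_of_finrank_eq_finrank hfin).1 hinj u
  exact ⟨p, hp⟩

/-- An upper triangular matrix with at least two eigenvalues commutes with an idempotent that is
a polynomial in it and has a given part of the spectrum as its support. -/
theorem exists_idempotent_polynomial (hA : A.BlockTriangular id) (x : K) :
    ∃ p : K[X], aeval A p * aeval A p = aeval A p ∧
      ∀ i, (A i i = x → p.eval (A i i) = 1) ∧ (A i i ≠ x → p.eval (A i i) = 0) := by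
  classical
  let a : K[X] := ∏ i with A i i = x, (X - C (A i i))
  let b : K[X] := ∏ i with ¬ A i i = x, (X - C (A i i))
  have hab : a * b = A.charpoly := by
    rw [Matrix.charpoly_of_isUpperTriangular A hA]
    exact Finset.prod_filter_mul_prod_filter_not _ _ _
  have hcop : IsCoprime a b := by
    refine IsCoprime.prod_left fun i hi => IsCoprime.prod_right fun j hj => ?_
    refine isCoprime_X_sub_C_of_isUnit_sub (IsUnit.mk0 _ (sub_ne_zero.2 fun h => ?_))
    exact (Finset.mem_filter.1 hj).2 (h ▸ (Finset.mem_filter.1 hi).2)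
  obtain ⟨u, w, huw⟩ := hcop
  -- Since `u * a + w * b = 1`, the polynomial `w * b` is `1` modulo `a` and `0` modulo `b`, hence
  -- idempotent modulo the characteristic polynomial `a * b`.
  refine ⟨w * b, ?_, fun i => ?_⟩
  · rw [← map_mul, ← sub_eq_zero, ← map_sub]
    have : w * b * (w * b) - w * b = - (u * w) * A.charpoly := by
      rw [← hab]
      linear_combination (w * b) * huw
    rw [this, map_mul, Matrix.aeval_self_charpoly, mul_zero]
  · refine ⟨fun h => ?_, fun h => ?_⟩
    · have ha : a.eval (A i i) = 0 := by
        rw [eval_prod]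
        exact Finset.prod_eq_zero (Finset.mem_filter.2 ⟨Finset.mem_univ i, h⟩) (by simp)
      have := congrArg (eval (A i i)) huw
      rw [eval_add, eval_mul, ha, mul_zero, zero_add, eval_one] at this
      exact this
    · have hb : b.eval (A i i) = 0 := by
        rw [eval_prod]
        exact Finset.prod_eq_zero (Finset.mem_filter.2 ⟨Finset.mem_univ i, h⟩) (by simp)
      rw [eval_mul, hb, mul_zero]

end Matrix.BlockTriangular

/-! ### Polynomial maps and closed or open conditions on matrix pairs -/

section MatPairTopology

open TopologicalSpace Topology MvPolynomial

attribute [local instance] zariskiTopology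

variable {K : Type*} {n : ℕ}

namespace MatPair

theorem coords_injective : Function.Injective (coords : MatPair K n → _ → K) := by
  intro p q h
  ext i j
  · exact congrFun h (Sum.inl (i, j))
  · exact congrFun h (Sum.inr (i, j))

/-- The pair of matrices with given coordinates. -/
def ofCoords (x : (Fin n × Fin n) ⊕ (Fin n × Fin n) → K) : MatPair K n :=
  ⟨Matrix.of fun i j => x (Sum.inl (i, j)), Matrix.of fun i j => x (Sum.inr (i, j))⟩

theorem coords_ofCoords (x : (Fin n × Fin n) ⊕ (Fin n × Fin n) → K) :
    (ofCoords x).coords = x := by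
  ext (⟨i, j⟩ | ⟨i, j⟩) <;> rfl

theorem ofCoords_coords (p : MatPair K n) : ofCoords p.coords = p :=
  coords_injective (coords_ofCoords _)

variable [Field K]

theorem isInducing_coords : IsInducing (coords : MatPair K n → _ → K) := ⟨rfl⟩

theorem isHomeomorph_coords : IsHomeomorph (coords : MatPair K n → _ → K) :=
  (Homeomorph.mk ⟨coords, ofCoords, ofCoords_coords, coords_ofCoords⟩
    isInducing_coords.continuous
    (isInducing_coords.continuous_iff.2 (by
      rw [show coords ∘ ofCoords (K := K) (n := n) = id from funext coords_ofCoords]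
      exact continuous_id))).isHomeomorph

end MatPair

variable [Field K]

/-- A matrix-valued function all of whose entries are polynomials in the coordinates `c`. -/
def IsRegularMap {A σ : Type*} {m k : ℕ} (c : A → σ → K) (F : A → Matrix (Fin m) (Fin k) K) : Prop :=
  ∀ i j, (fun a => F a i j) ∈ regularFunctions c

namespace IsRegularMap

variable {A σ : Type*} {c : A → σ → K} {m k l : ℕ}

theorem X : IsRegularMap (MatPair.coords (K := K) (n := n)) MatPair.X := fun i j =>
  coord_mem_regularFunctions _ (Sum.inl (i, j))

theorem Y : IsRegularMap (MatPair.coords (K := K) (n := n)) MatPair.Y := fun i j =>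
  coord_mem_regularFunctions _ (Sum.inr (i, j))

theorem const (M : Matrix (Fin m) (Fin k) K) : IsRegularMap c fun _ => M := fun i j =>
  const_mem_regularFunctions c (M i j)

theorem add {F G : A → Matrix (Fin m) (Fin k) K} (hF : IsRegularMap c F) (hG : IsRegularMap c G) :
    IsRegularMap c fun a => F a + G a := fun i j =>
  (regularFunctions c).add_mem (hF i j) (hG i j)

theorem sub {F G : A → Matrix (Fin m) (Fin k) K} (hF : IsRegularMap c F) (hG : IsRegularMap c G) :
    IsRegularMap c fun a => F a - G a := fun i j =>
  (regularFunctions c).sub_mem (hF i j) (hG i j)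

theorem smul {f : A → K} {F : A → Matrix (Fin m) (Fin k) K} (hf : f ∈ regularFunctions c)
    (hF : IsRegularMap c F) : IsRegularMap c fun a => f a • F a := fun i j =>
  (regularFunctions c).mul_mem hf (hF i j)

theorem sum {ι : Type*} {s : Finset ι} {F : ι → A → Matrix (Fin m) (Fin k) K}
    (hF : ∀ t ∈ s, IsRegularMap c (F t)) : IsRegularMap c fun a => ∑ t ∈ s, F t a := fun i j => by
  have h : (fun a => (∑ t ∈ s, F t a) i j) = ∑ t ∈ s, fun a => F t a i j := by
    ext a
    rw [Matrix.sum_apply, Finset.sum_apply]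
  rw [h]
  exact (regularFunctions c).sum_mem fun t ht => hF t ht i j

theorem mul {F : A → Matrix (Fin m) (Fin k) K} {G : A → Matrix (Fin k) (Fin l) K}
    (hF : IsRegularMap c F) (hG : IsRegularMap c G) : IsRegularMap c fun a => F a * G a :=
  fun i j => by
  have h : (fun a => (F a * G a) i j) = ∑ t, (fun a => F a i t) * fun a => G a t j := by
    ext a
    rw [Matrix.mul_apply, Finset.sum_apply]
    rfl
  rw [h]
  exact (regularFunctions c).sum_mem fun t _ => (regularFunctions c).mul_mem (hF i t) (hG t j)

theorem pow {F : A → Matrix (Fin m) (Fin m) K} (hF : IsRegularMap c F) (e : ℕ) :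
    IsRegularMap c fun a => F a ^ e := by
  induction e with
  | zero => simpa using const 1
  | succ e ih => simpa only [pow_succ] using ih.mul hF

theorem submatrix {m' k' : ℕ} {F : A → Matrix (Fin m) (Fin k) K} (hF : IsRegularMap c F)
    (f : Fin m' → Fin m) (g : Fin k' → Fin k) : IsRegularMap c fun a => (F a).submatrix f g :=
  fun i j => hF (f i) (g j)

theorem continuous_mk [TopologicalSpace A] (hc : IsInducing c) {F G : A → Matrix (Fin n) (Fin n) K}
    (hF : IsRegularMap c F) (hG : IsRegularMap c G) :
    Continuous fun a => (⟨F a, G a⟩ : MatPair K n) :=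
  continuous_of_regular hc MatPair.isInducing_coords (by
    rintro (⟨i, j⟩ | ⟨i, j⟩)
    · exact hF i j
    · exact hG i j)

theorem isClosed_setOf_eq [TopologicalSpace A] (hc : IsInducing c)
    {F G : A → Matrix (Fin m) (Fin k) K} (hF : IsRegularMap c F) (hG : IsRegularMap c G) :
    IsClosed {a | F a = G a} := by
  have : {a | F a = G a} = ⋂ i, ⋂ j, {a | (F a - G a) i j = 0} := by
    ext a
    simp [← Matrix.ext_iff, sub_eq_zero]
  rw [this]
  exact isClosed_iInter fun i => isClosed_iInter fun j =>
    isClosed_setOf_eq_zero_of_regular hc (hF.sub hG i j)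

theorem isClosed_setOf_apply_eq [TopologicalSpace A] (hc : IsInducing c)
    {F : A → Matrix (Fin m) (Fin k) K} (hF : IsRegularMap c F) (i i' : Fin m) (j j' : Fin k) :
    IsClosed {a | F a i j = F a i' j'} := by
  simp_rw [← sub_eq_zero (a := F _ i j)]
  exact isClosed_setOf_eq_zero_of_regular hc
    ((regularFunctions c).sub_mem (hF i j) (hF i' j'))

theorem isClosed_setOf_apply_eq_const [TopologicalSpace A] (hc : IsInducing c)
    {F : A → Matrix (Fin m) (Fin k) K} (hF : IsRegularMap c F) (i : Fin m) (j : Fin k) (x : K) :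
    IsClosed {a | F a i j = x} := by
  simp_rw [← sub_eq_zero (a := F _ i j)]
  exact isClosed_setOf_eq_zero_of_regular hc
    ((regularFunctions c).sub_mem (hF i j) (const_mem_regularFunctions c x))

theorem isClosed_setOf_blockTriangular [TopologicalSpace A] (hc : IsInducing c)
    {F : A → Matrix (Fin m) (Fin m) K} (hF : IsRegularMap c F) :
    IsClosed {a | (F a).BlockTriangular id} := by
  have : {a | (F a).BlockTriangular id} = ⋂ i, ⋂ j, ⋂ _ : j < i, {a | F a i j = 0} := by
    ext a
    simp [Matrix.BlockTriangular]
  rw [this]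
  exact isClosed_iInter fun i => isClosed_iInter fun j => isClosed_iInter fun _ =>
    hF.isClosed_setOf_apply_eq_const hc i j 0

/-- The diagonal entries with index in `S` being distinct and outside a finite set is an open
condition. -/
theorem isOpen_setOf_injOn_diag [TopologicalSpace A] (hc : IsInducing c)
    {F : A → Matrix (Fin m) (Fin m) K} (hF : IsRegularMap c F) (S : Finset (Fin m)) (E : Finset K) :
    IsOpen {a | Set.InjOn (F a).diag S ∧ ∀ i ∈ S, F a i i ∉ E} := by
  have : {a | Set.InjOn (F a).diag S ∧ ∀ i ∈ S, F a i i ∉ E} =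
      (⋂ i ∈ S, ⋂ j ∈ S, ⋂ _ : i ≠ j, {a | F a i i = F a j j}ᶜ) ∩
        ⋂ i ∈ S, ⋂ x ∈ E, {a | F a i i = x}ᶜ := by
    ext a
    simp only [Set.mem_ofPred_eq, Set.mem_inter_iff, Set.mem_iInter, Set.mem_compl_iff]
    refine and_congr ⟨fun h i hi j hj hij he => hij (h hi hj he), fun h i hi j hj he => ?_⟩ ?_
    · by_contra hij
      exact h i hi j hj hij he
    · exact forall₂_congr fun i hi => ⟨fun h x hx he => h (he ▸ hx), fun h he => h _ he rfl⟩
  rw [this]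
  refine IsOpen.inter ?_ ?_
  · refine isOpen_biInter_finset fun i _ => isOpen_biInter_finset fun j _ =>
      isOpen_iInter_of_finite fun _ => ?_
    exact (hF.isClosed_setOf_apply_eq hc i j i j).isOpen_compl
  · refine isOpen_biInter_finset fun i _ => isOpen_biInter_finset fun x _ => ?_
    exact (hF.isClosed_setOf_apply_eq_const hc i i x).isOpen_compl

end IsRegularMap

theorem isClosed_CT : IsClosed (CT K n) := by
  have hX := IsRegularMap.X (K := K) (n := n)
  have hY := IsRegularMap.Y (K := K) (n := n)
  have hc := MatPair.isInducing_coords (K := K) (n := n)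
  exact (hX.isClosed_setOf_blockTriangular hc).inter ((hY.isClosed_setOf_blockTriangular hc).inter
    ((hX.mul hY).isClosed_setOf_eq hc (hY.mul hX)))

/-- The pairs in `CT_n` in which each matrix has `n` distinct eigenvalues. -/
def distinctCT (K : Type*) [Field K] (n : ℕ) : Set (MatPair K n) :=
  {p | p ∈ CT K n ∧ Function.Injective p.X.diag ∧ Function.Injective p.Y.diag}

theorem CT0_subset_CT : CT0 K n ⊆ CT K n :=
  closure_minimal (fun _ h => h.1) isClosed_CT

theorem closure_distinctCT_subset_CT0 : closure (distinctCT K n) ⊆ CT0 K n :=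
  closure_mono fun _ h => ⟨h.1, h.1.1.natDegree_minpoly_of_injective_diag h.2.1,
    h.1.2.1.natDegree_minpoly_of_injective_diag h.2.2⟩

end MatPairTopology

/-! ### Pairs supported on blocks and perturbation of their eigenvalues -/

section BlockDecomposition

open TopologicalSpace Topology MvPolynomial

attribute [local instance] zariskiTopology

variable {K : Type*} [Field K] {n : ℕ}

theorem Matrix.submatrix_mul_of_injective {R ι κ : Type*} [NonUnitalNonAssocSemiring R] [Fintype ι]
    [Fintype κ] {A B : Matrix ι ι R} {f : κ → ι} (hf : Function.Injective f)
    (h : ∀ a b, ∀ i ∉ Set.range f, A (f a) i * B i (f b) = 0) :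
    (A * B).submatrix f f = A.submatrix f f * B.submatrix f f := by
  ext a b
  rw [Matrix.submatrix_apply, Matrix.mul_apply, Matrix.mul_apply]
  exact (Fintype.sum_of_injective f hf _ _ (h a b) fun _ => rfl).symm

/-- The matrix with entries `M a b` at the positions `(f a, f b)` and zeros elsewhere. -/
def Matrix.extendByZero {k : ℕ} (f : Fin k → Fin n) (M : Matrix (Fin k) (Fin k) K) :
    Matrix (Fin n) (Fin n) K :=
  (1 : Matrix (Fin n) (Fin n) K).submatrix id f * M * (1 : Matrix (Fin n) (Fin n) K).submatrix f id

namespace Matrix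

variable {k : ℕ} {f : Fin k → Fin n} {M N : Matrix (Fin k) (Fin k) K}

theorem extendByZero_apply_of_notMem_left {i j : Fin n} (hi : i ∉ Set.range f) :
    extendByZero f M i j = 0 := by
  rw [extendByZero, Matrix.mul_assoc, Matrix.mul_apply]
  refine Finset.sum_eq_zero fun a _ => ?_
  rw [Matrix.submatrix_apply, Matrix.one_apply_ne, zero_mul]
  rintro rfl
  exact hi ⟨a, rfl⟩

theorem extendByZero_apply_of_notMem_right {i j : Fin n} (hj : j ∉ Set.range f) :
    extendByZero f M i j = 0 := by
  rw [extendByZero, Matrix.mul_apply]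
  refine Finset.sum_eq_zero fun a _ => ?_
  rw [Matrix.submatrix_apply, Matrix.one_apply_ne, mul_zero]
  intro h
  exact hj ⟨a, h⟩

theorem submatrix_extendByZero (hf : Function.Injective f) :
    (extendByZero f M).submatrix f f = M := by
  rw [extendByZero, Matrix.submatrix_mul _ _ f id f Function.bijective_id,
    Matrix.submatrix_mul _ _ f id id Function.bijective_id]
  simp [Matrix.submatrix_one f hf]

theorem extendByZero_mul (hf : Function.Injective f) :
    extendByZero f (M * N) = extendByZero f M * extendByZero f N := by
  have h : (1 : Matrix (Fin n) (Fin n) K).submatrix f id *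
      (1 : Matrix (Fin n) (Fin n) K).submatrix id f = 1 := by
    rw [← Matrix.submatrix_mul _ _ f id f Function.bijective_id, one_mul, Matrix.submatrix_one f hf]
  simp only [extendByZero, Matrix.mul_assoc]
  rw [← Matrix.mul_assoc (submatrix 1 f id) (submatrix 1 id f), h, Matrix.one_mul]

theorem extendByZero_submatrix (hf : Function.Injective f) {A : Matrix (Fin n) (Fin n) K}
    (hA : ∀ i j, ¬ (i ∈ Set.range f ∧ j ∈ Set.range f) → A i j = 0) :
    extendByZero f (A.submatrix f f) = A := by
  ext i j
  by_cases hi : i ∈ Set.range f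
  · by_cases hj : j ∈ Set.range f
    · obtain ⟨a, rfl⟩ := hi
      obtain ⟨b, rfl⟩ := hj
      exact congrFun (congrFun (submatrix_extendByZero (M := A.submatrix f f) hf) a) b
    · rw [extendByZero_apply_of_notMem_right hj, hA i j fun h => hj h.2]
  · rw [extendByZero_apply_of_notMem_left hi, hA i j fun h => hi h.1]

theorem extendByZero_blockTriangular (hf : StrictMono f) (hM : M.BlockTriangular id) :
    (extendByZero f M).BlockTriangular id := by
  intro i j hij
  by_cases hi : i ∈ Set.range f
  · by_cases hj : j ∈ Set.range f
    · obtain ⟨a, rfl⟩ := hi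
      obtain ⟨b, rfl⟩ := hj
      exact (congrFun (congrFun (submatrix_extendByZero (M := M) hf.injective) a) b).trans
        (hM (hf.lt_iff_lt.1 hij))
    · exact extendByZero_apply_of_notMem_right hj
  · exact extendByZero_apply_of_notMem_left hi

theorem BlockTriangular.submatrix_strictMono {A : Matrix (Fin n) (Fin n) K}
    (hA : A.BlockTriangular id) (hf : StrictMono f) : (A.submatrix f f).BlockTriangular id :=
  fun _ _ hij => hA (hf hij)

end Matrix

namespace MatPair

/-- Extension by zero of both matrices of a pair. -/
def extendByZero {k : ℕ} (f : Fin k → Fin n) (p : MatPair K k) : MatPair K n :=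
  ⟨p.X.extendByZero f, p.Y.extendByZero f⟩

theorem continuous_extendByZero {k : ℕ} (f : Fin k → Fin n) :
    Continuous (extendByZero (K := K) f) :=
  IsRegularMap.continuous_mk isInducing_coords
    (((IsRegularMap.const _).mul .X).mul (IsRegularMap.const _))
    (((IsRegularMap.const _).mul .Y).mul (IsRegularMap.const _))

theorem extendByZero_mem_CT {k : ℕ} {f : Fin k → Fin n} (hf : StrictMono f) {p : MatPair K k}
    (hp : p ∈ CT K k) : extendByZero f p ∈ CT K n := by
  refine ⟨Matrix.extendByZero_blockTriangular hf hp.1,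
    Matrix.extendByZero_blockTriangular hf hp.2.1, ?_⟩
  simp only [extendByZero]
  rw [← Matrix.extendByZero_mul hf.injective, hp.2.2, Matrix.extendByZero_mul hf.injective]

end MatPair

/-- Taking the leading `k × k` corner is multiplicative on triangular matrices, and extension by
zero shows that it maps `CT K m` onto `CT K k`. -/
theorem isIrreducible_CT_of_le {k m : ℕ} (hkm : k ≤ m) (h : IsIrreducible (CT K m)) :
    IsIrreducible (CT K k) := by
  have hf : StrictMono (Fin.castLE hkm) := Fin.strictMono_castLE hkm
  have hmul : ∀ A B : Matrix (Fin m) (Fin m) K, B.BlockTriangular id →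
      (A * B).submatrix (Fin.castLE hkm) (Fin.castLE hkm) =
        A.submatrix (Fin.castLE hkm) (Fin.castLE hkm) *
          B.submatrix (Fin.castLE hkm) (Fin.castLE hkm) := by
    intro A B hB
    refine Matrix.submatrix_mul_of_injective hf.injective fun a b i hi => ?_
    rw [hB, mul_zero]
    rw [Fin.range_castLE] at hi
    simp only [Set.mem_ofPred_eq, not_lt] at hi
    exact Fin.lt_def.2 (lt_of_lt_of_le b.2 hi)
  have himg : (fun p : MatPair K m => (⟨p.X.submatrix (Fin.castLE hkm) (Fin.castLE hkm),
      p.Y.submatrix (Fin.castLE hkm) (Fin.castLE hkm)⟩ : MatPair K k)) '' CT K m = CT K k := by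
    ext q
    constructor
    · rintro ⟨p, hp, rfl⟩
      refine ⟨hp.1.submatrix_strictMono hf, hp.2.1.submatrix_strictMono hf, ?_⟩
      dsimp only
      rw [← hmul _ _ hp.2.1, ← hmul _ _ hp.1, hp.2.2]
    · intro hq
      refine ⟨q.extendByZero (Fin.castLE hkm), MatPair.extendByZero_mem_CT hf hq, ?_⟩
      simp only [MatPair.extendByZero, Matrix.submatrix_extendByZero hf.injective]
  rw [← himg]
  exact h.image _ (IsRegularMap.continuous_mk MatPair.isInducing_coords
    (IsRegularMap.X.submatrix _ _) (IsRegularMap.Y.submatrix _ _)).continuousOn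

/-- The pairs in `CT_n` whose entries vanish outside of `S × S`. -/
def blockCT (K : Type*) [Field K] {n : ℕ} (S : Finset (Fin n)) : Set (MatPair K n) :=
  {p | p ∈ CT K n ∧ (∀ i j, ¬ (i ∈ S ∧ j ∈ S) → p.X i j = 0) ∧
    ∀ i j, ¬ (i ∈ S ∧ j ∈ S) → p.Y i j = 0}

/-- The increasing enumeration of `S` preserves triangularity, so the block is an image of `CT K
S.card`. -/
theorem isIrreducible_blockCT {m : ℕ} {S : Finset (Fin n)} (hS : S.card ≤ m)
    (h : IsIrreducible (CT K m)) : IsIrreducible (blockCT K S) := by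
  let f := S.orderEmbOfFin rfl
  have hf : StrictMono f := f.strictMono
  have hrange : ∀ i, i ∈ Set.range f ↔ i ∈ S := fun i => by
    rw [Finset.range_orderEmbOfFin, Finset.mem_coe]
  have himg : MatPair.extendByZero f '' CT K S.card = blockCT K S := by
    ext q
    constructor
    · rintro ⟨p, hp, rfl⟩
      refine ⟨MatPair.extendByZero_mem_CT hf hp, fun i j hij => ?_, fun i j hij => ?_⟩
      all_goals
        rw [← hrange, ← hrange, not_and_or] at hij
        rcases hij with hi | hj
        · exact Matrix.extendByZero_apply_of_notMem_left hi
        · exact Matrix.extendByZero_apply_of_notMem_right hj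
    · intro hq
      have hX : ∀ i j, ¬ (i ∈ Set.range f ∧ j ∈ Set.range f) → q.X i j = 0 := by
        simpa only [hrange] using hq.2.1
      have hY : ∀ i j, ¬ (i ∈ Set.range f ∧ j ∈ Set.range f) → q.Y i j = 0 := by
        simpa only [hrange] using hq.2.2
      refine ⟨⟨q.X.submatrix f f, q.Y.submatrix f f⟩, ⟨hq.1.1.submatrix_strictMono hf,
        hq.1.2.1.submatrix_strictMono hf, ?_⟩, ?_⟩
      · dsimp only
        rw [← Matrix.submatrix_mul_of_injective hf.injective,
          ← Matrix.submatrix_mul_of_injective hf.injective, hq.1.2.2]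
        · intro a b i hi
          rw [hY _ _ fun h => hi h.2, zero_mul]
        · intro a b i hi
          rw [hX _ _ fun h => hi h.2, zero_mul]
      · simp only [MatPair.extendByZero, Matrix.extendByZero_submatrix hf.injective hX,
          Matrix.extendByZero_submatrix hf.injective hY]
  rw [← himg]
  exact (isIrreducible_CT_of_le hS h).image _ (MatPair.continuous_extendByZero f).continuousOn

theorem exists_injective_notMem_finset {K : Type*} [Infinite K] (E : Finset K) :
    ∃ g : Fin n → K, Function.Injective g ∧ ∀ i, g i ∉ E := by
  have hinf : (E : Set K)ᶜ.Infinite := E.finite_toSet.infinite_compl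
  refine ⟨fun i => hinf.natEmbedding _ i, fun i j hij => ?_, fun i => (hinf.natEmbedding _ i).2⟩
  exact Fin.val_injective ((hinf.natEmbedding _).injective (Subtype.ext hij))

theorem MatPair.diagonal_mem_CT (g : Fin n → K) :
    (⟨Matrix.diagonal g, Matrix.diagonal g⟩ : MatPair K n) ∈ CT K n :=
  ⟨Matrix.blockTriangular_diagonal g, Matrix.blockTriangular_diagonal g, rfl⟩

/-- The condition is open and a suitable diagonal pair satisfies it, so irreducibility makes it
dense. The sets `E` and `F` serve to avoid the eigenvalues of a complementary block. -/
theorem blockCT_subset_closure [Infinite K] {S : Finset (Fin n)} (h : IsIrreducible (blockCT K S))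
    (E F : Finset K) :
    blockCT K S ⊆ closure (blockCT K S ∩
      ({p | Set.InjOn p.X.diag S ∧ ∀ i ∈ S, p.X i i ∉ E} ∩
        {p | Set.InjOn p.Y.diag S ∧ ∀ i ∈ S, p.Y i i ∉ F})) := by
  classical
  refine subset_closure_inter_of_isPreirreducible_of_isOpen h.2
    ((IsRegularMap.X.isOpen_setOf_injOn_diag MatPair.isInducing_coords S E).inter
      (IsRegularMap.Y.isOpen_setOf_injOn_diag MatPair.isInducing_coords S F)) ?_
  obtain ⟨g, hg, hgE⟩ := exists_injective_notMem_finset (n := n) (E ∪ F)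
  let g' : Fin n → K := fun i => if i ∈ S then g i else 0
  have hg' : ∀ i ∈ S, g' i = g i := fun i hi => if_pos hi
  have hzero : ∀ i j, ¬ (i ∈ S ∧ j ∈ S) → Matrix.diagonal g' i j = 0 := by
    intro i j hij
    rcases eq_or_ne i j with rfl | hne
    · rw [Matrix.diagonal_apply_eq]
      exact if_neg fun hi => hij ⟨hi, hi⟩
    · exact Matrix.diagonal_apply_ne _ hne
  have hinj : Set.InjOn (Matrix.diagonal g').diag S := by
    intro i hi j hj hij
    rw [Matrix.diag_diagonal, hg' i hi, hg' j hj] at hij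
    exact hg hij
  have hmem : ∀ i ∈ S, Matrix.diagonal g' i i ∉ E ∪ F := by
    intro i hi
    rw [Matrix.diagonal_apply_eq, hg' i hi]
    exact hgE i
  exact ⟨⟨Matrix.diagonal g', Matrix.diagonal g'⟩, ⟨MatPair.diagonal_mem_CT g', hzero, hzero⟩,
    ⟨hinj, fun i hi h => hmem i hi (Finset.mem_union_left _ h)⟩,
    ⟨hinj, fun i hi h => hmem i hi (Finset.mem_union_right _ h)⟩⟩

instance : Add (MatPair K n) := ⟨fun p q => ⟨p.X + q.X, p.Y + q.Y⟩⟩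

theorem MatPair.X_add (p q : MatPair K n) : (p + q).X = p.X + q.X := rfl

theorem MatPair.Y_add (p q : MatPair K n) : (p + q).Y = p.Y + q.Y := rfl

theorem MatPair.continuous_add_right (q : MatPair K n) : Continuous fun p => p + q :=
  IsRegularMap.continuous_mk isInducing_coords
    (IsRegularMap.X.add (IsRegularMap.const _)) (IsRegularMap.Y.add (IsRegularMap.const _))

theorem MatPair.continuous_add_left (q : MatPair K n) : Continuous fun p => q + p :=
  IsRegularMap.continuous_mk isInducing_coords
    ((IsRegularMap.const _).add IsRegularMap.X) ((IsRegularMap.const _).add IsRegularMap.Y)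

theorem mul_eq_zero_of_disjoint_support {S : Finset (Fin n)} {A B : Matrix (Fin n) (Fin n) K}
    (hA : ∀ i j, ¬ (i ∈ S ∧ j ∈ S) → A i j = 0) (hB : ∀ i j, ¬ (i ∈ Sᶜ ∧ j ∈ Sᶜ) → B i j = 0) :
    A * B = 0 ∧ B * A = 0 := by
  constructor
  · ext i j
    rw [Matrix.mul_apply, Matrix.zero_apply]
    refine Finset.sum_eq_zero fun k _ => ?_
    by_cases hk : k ∈ S
    · rw [hB k j fun h => Finset.mem_compl.1 h.1 hk, mul_zero]
    · rw [hA i k fun h => hk h.2, zero_mul]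
  · ext i j
    rw [Matrix.mul_apply, Matrix.zero_apply]
    refine Finset.sum_eq_zero fun k _ => ?_
    by_cases hk : k ∈ S
    · rw [hB i k fun h => Finset.mem_compl.1 h.2 hk, zero_mul]
    · rw [hA k j fun h => hk h.1, mul_zero]

theorem injective_diag_add {S : Finset (Fin n)} {A B : Matrix (Fin n) (Fin n) K}
    (hA : ∀ i j, ¬ (i ∈ S ∧ j ∈ S) → A i j = 0) (hB : ∀ i j, ¬ (i ∈ Sᶜ ∧ j ∈ Sᶜ) → B i j = 0)
    (hAi : Set.InjOn A.diag S) (hBi : Set.InjOn B.diag (Sᶜ : Finset (Fin n)))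
    (hAB : ∀ i ∈ S, ∀ j ∈ Sᶜ, A i i ≠ B j j) : Function.Injective (A + B).diag := by
  have h1 : ∀ i ∈ S, (A + B).diag i = A i i := fun i hi => by
    rw [Matrix.diag_apply, Matrix.add_apply, hB i i fun h => Finset.mem_compl.1 h.1 hi, add_zero]
  have h2 : ∀ i ∉ S, (A + B).diag i = B i i := fun i hi => by
    rw [Matrix.diag_apply, Matrix.add_apply, hA i i fun h => hi h.1, zero_add]
  intro i j hij
  by_cases hi : i ∈ S <;> by_cases hj : j ∈ S
  · rw [h1 i hi, h1 j hj] at hij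
    exact hAi hi hj hij
  · rw [h1 i hi, h2 j hj] at hij
    exact (hAB i hi j (Finset.mem_compl.2 hj) hij).elim
  · rw [h2 i hi, h1 j hj] at hij
    exact (hAB j hj i (Finset.mem_compl.2 hi) hij.symm).elim
  · rw [h2 i hi, h2 j hj] at hij
    exact hBi (Finset.mem_coe.2 (Finset.mem_compl.2 hi)) (Finset.mem_coe.2 (Finset.mem_compl.2 hj))
      hij

theorem add_mem_CT_of_mem_blockCT {S : Finset (Fin n)} {p q : MatPair K n} (hp : p ∈ blockCT K S)
    (hq : q ∈ blockCT K Sᶜ) : p + q ∈ CT K n := by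
  refine ⟨hp.1.1.add hq.1.1, hp.1.2.1.add hq.1.2.1, ?_⟩
  rw [MatPair.X_add, MatPair.Y_add, add_mul, mul_add, mul_add, add_mul, mul_add, mul_add,
    (mul_eq_zero_of_disjoint_support hp.2.1 hq.2.2).1,
    (mul_eq_zero_of_disjoint_support hp.2.1 hq.2.2).2,
    (mul_eq_zero_of_disjoint_support hp.2.2 hq.2.1).1,
    (mul_eq_zero_of_disjoint_support hp.2.2 hq.2.1).2, hp.1.2.2, hq.1.2.2]

/-- The blocks are perturbed one after the other, so that only continuity of addition in each
variable separately is needed; the Zariski topology of a product is not the product topology. -/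
theorem add_mem_closure_distinctCT [Infinite K] {S : Finset (Fin n)}
    (h : IsIrreducible (blockCT K S)) (h' : IsIrreducible (blockCT K Sᶜ)) {p q : MatPair K n}
    (hp : p ∈ blockCT K S) (hq : q ∈ blockCT K Sᶜ) : p + q ∈ closure (distinctCT K n) := by
  classical
  have key : Set.MapsTo (fun r => r + q) (blockCT K S ∩
      ({p | Set.InjOn p.X.diag S ∧ ∀ i ∈ S, p.X i i ∉ (∅ : Finset K)} ∩
        {p | Set.InjOn p.Y.diag S ∧ ∀ i ∈ S, p.Y i i ∉ (∅ : Finset K)}))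
      (closure (distinctCT K n)) := by
    rintro r ⟨hr, ⟨hrX, -⟩, ⟨hrY, -⟩⟩
    -- The diagonal of `r` also has zeros outside `S`; excluding the value `0` as well does no harm.
    have key' : Set.MapsTo (fun s => r + s) (blockCT K Sᶜ ∩
        ({p | Set.InjOn p.X.diag (Sᶜ : Finset (Fin n)) ∧
            ∀ i ∈ Sᶜ, p.X i i ∉ Finset.univ.image r.X.diag} ∩
          {p | Set.InjOn p.Y.diag (Sᶜ : Finset (Fin n)) ∧
            ∀ i ∈ Sᶜ, p.Y i i ∉ Finset.univ.image r.Y.diag})) (distinctCT K n) := by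
      rintro s ⟨hs, ⟨hsX, hsX'⟩, ⟨hsY, hsY'⟩⟩
      refine ⟨add_mem_CT_of_mem_blockCT hr hs,
        injective_diag_add hr.2.1 hs.2.1 hrX hsX fun i _ j hj he => ?_,
        injective_diag_add hr.2.2 hs.2.2 hrY hsY fun i _ j hj he => ?_⟩
      · exact hsX' j hj (Finset.mem_image.2 ⟨i, Finset.mem_univ i, he⟩)
      · exact hsY' j hj (Finset.mem_image.2 ⟨i, Finset.mem_univ i, he⟩)
    exact key'.closure (MatPair.continuous_add_left r) (blockCT_subset_closure h' _ _ hq)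
  have := key.closure (MatPair.continuous_add_right q) (blockCT_subset_closure h _ _ hp)
  rwa [closure_closure] at this

end BlockDecomposition

/-! ### Splitting along eigenvalues, and parametrization of the regular pairs -/

section RegularPairs

open TopologicalSpace Topology MvPolynomial

attribute [local instance] zariskiTopology

variable {K : Type*} [Field K] {n : ℕ}

/-- The projection to the coordinates in `S`. -/
def coordProj (K : Type*) [Field K] (S : Finset (Fin n)) : Matrix (Fin n) (Fin n) K :=
  Matrix.diagonal fun i => if i ∈ S then 1 else 0

theorem coordProj_compl (S : Finset (Fin n)) : coordProj K Sᶜ = 1 - coordProj K S := by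
  ext i j
  rcases eq_or_ne i j with rfl | h
  · by_cases hi : i ∈ S <;> simp [coordProj, hi]
  · simp [coordProj, h]

theorem coordProj_mul_self (S : Finset (Fin n)) :
    coordProj K S * coordProj K S = coordProj K S := by
  simp [coordProj, Matrix.diagonal_mul_diagonal]

theorem coordProj_mul_mem_blockCT {S : Finset (Fin n)} {p : MatPair K n} (hp : p ∈ CT K n)
    (hX : coordProj K S * p.X = p.X * coordProj K S)
    (hY : coordProj K S * p.Y = p.Y * coordProj K S) :
    (⟨coordProj K S * p.X, coordProj K S * p.Y⟩ : MatPair K n) ∈ blockCT K S := by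
  have hd : (coordProj K S).BlockTriangular id := Matrix.blockTriangular_diagonal _
  have hzero : ∀ A : Matrix (Fin n) (Fin n) K, coordProj K S * A = A * coordProj K S →
      ∀ i j, ¬ (i ∈ S ∧ j ∈ S) → (coordProj K S * A) i j = 0 := by
    intro A hA i j hij
    rw [not_and_or] at hij
    rcases hij with hi | hj
    · simp [coordProj, Matrix.diagonal_mul, hi]
    · rw [hA]
      simp [coordProj, Matrix.mul_diagonal, hj]
  refine ⟨⟨hd.mul hp.1, hd.mul hp.2.1, ?_⟩, hzero _ hX, hzero _ hY⟩
  dsimp only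
  rw [mul_assoc, ← mul_assoc p.X, ← hX, mul_assoc (coordProj K S) p.X, hp.2.2, mul_assoc,
    ← mul_assoc p.Y, ← hY, mul_assoc (coordProj K S) p.Y]

/-- The pair is the sum of its parts on `S` and on the complement. Both index sets are nonempty, so
each has at most `n - 1` elements and irreducibility of `CT K (n - 1)` applies. -/
theorem mem_closure_distinctCT_of_commute_coordProj [Infinite K]
    (hirr : IsIrreducible (CT K (n - 1))) {S : Finset (Fin n)} (hS : S.Nonempty)
    (hS' : Sᶜ.Nonempty) {p : MatPair K n} (hp : p ∈ CT K n)
    (hX : coordProj K S * p.X = p.X * coordProj K S)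
    (hY : coordProj K S * p.Y = p.Y * coordProj K S) : p ∈ closure (distinctCT K n) := by
  have hcard := Finset.card_add_card_compl S
  rw [Fintype.card_fin] at hcard
  have h1 := hS.card_pos
  have h2 := hS'.card_pos
  have key := add_mem_closure_distinctCT
    (isIrreducible_blockCT (S := S) (by omega) hirr)
    (isIrreducible_blockCT (S := Sᶜ) (by omega) hirr)
    (coordProj_mul_mem_blockCT hp hX hY)
    (coordProj_mul_mem_blockCT (S := Sᶜ) hp
      (by rw [coordProj_compl, sub_mul, mul_sub, hX, one_mul, mul_one])
      (by rw [coordProj_compl, sub_mul, mul_sub, hY, one_mul, mul_one]))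
  convert key using 1
  ext1
  · rw [MatPair.X_add, ← add_mul, coordProj_compl, add_sub_cancel, one_mul]
  · rw [MatPair.Y_add, ← add_mul, coordProj_compl, add_sub_cancel, one_mul]

section Conjugation

variable {g : Matrix (Fin n) (Fin n) K}

theorem Matrix.BlockTriangular.inv_of_isUnit_det (hg : g.BlockTriangular id)
    (hdet : IsUnit g.det) : g⁻¹.BlockTriangular id := by
  have := Matrix.invertibleOfIsUnitDet g hdet
  exact Matrix.blockTriangular_inv_of_blockTriangular hg

theorem Matrix.BlockTriangular.conj_apply_self (hg : g.BlockTriangular id) (hdet : IsUnit g.det)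
    {A : Matrix (Fin n) (Fin n) K} (hA : A.BlockTriangular id) (i : Fin n) :
    (g * A * g⁻¹) i i = A i i := by
  have h := congrFun (congrFun (Matrix.mul_nonsing_inv g hdet) i) i
  rw [hg.mul_apply_self (hg.inv_of_isUnit_det hdet), Matrix.one_apply_eq] at h
  rw [(hg.mul hA).mul_apply_self (hg.inv_of_isUnit_det hdet), hg.mul_apply_self hA,
    mul_right_comm, h, one_mul]

theorem conj_mem_CT (hg : g.BlockTriangular id) (hdet : IsUnit g.det) {p : MatPair K n}
    (hp : p ∈ CT K n) : (⟨g * p.X * g⁻¹, g * p.Y * g⁻¹⟩ : MatPair K n) ∈ CT K n := by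
  have hinv := hg.inv_of_isUnit_det hdet
  refine ⟨(hg.mul hp.1).mul hinv, (hg.mul hp.2.1).mul hinv, ?_⟩
  have h : ∀ A B : Matrix (Fin n) (Fin n) K, g * A * g⁻¹ * (g * B * g⁻¹) = g * (A * B) * g⁻¹ := by
    intro A B
    calc g * A * g⁻¹ * (g * B * g⁻¹) = g * A * (g⁻¹ * g) * B * g⁻¹ := by simp only [mul_assoc]
      _ = _ := by rw [Matrix.nonsing_inv_mul g hdet, mul_one]; simp only [mul_assoc]
  dsimp only
  rw [h, h, hp.2.2]

theorem conj_mem_closure_distinctCT (hg : g.BlockTriangular id) (hdet : IsUnit g.det)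
    {p : MatPair K n} (hp : p ∈ closure (distinctCT K n)) :
    (⟨g * p.X * g⁻¹, g * p.Y * g⁻¹⟩ : MatPair K n) ∈ closure (distinctCT K n) := by
  have hmaps : Set.MapsTo (fun p : MatPair K n => (⟨g * p.X * g⁻¹, g * p.Y * g⁻¹⟩ : MatPair K n))
      (distinctCT K n) (distinctCT K n) := by
    intro q hq
    refine ⟨conj_mem_CT hg hdet hq.1, fun i j hij => hq.2.1 ?_, fun i j hij => hq.2.2 ?_⟩
    · simpa only [Matrix.diag_apply, hg.conj_apply_self hdet hq.1.1] using hij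
    · simpa only [Matrix.diag_apply, hg.conj_apply_self hdet hq.1.2.1] using hij
  exact hmaps.closure (IsRegularMap.continuous_mk MatPair.isInducing_coords
    (((IsRegularMap.const _).mul .X).mul (IsRegularMap.const _))
    (((IsRegularMap.const _).mul .Y).mul (IsRegularMap.const _))) hp

/-- An upper triangular idempotent is conjugate to a coordinate projection under the group of
upper triangular matrices. -/
theorem Matrix.BlockTriangular.exists_conj_coordProj {e : Matrix (Fin n) (Fin n) K}
    (he : e.BlockTriangular id) (hee : e * e = e) {S : Finset (Fin n)}
    (hS : ∀ i, (i ∈ S → e i i = 1) ∧ (i ∉ S → e i i = 0)) :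
    ∃ g : Matrix (Fin n) (Fin n) K, g.BlockTriangular id ∧ IsUnit g.det ∧
      e * g = g * coordProj K S := by
  have hd : (coordProj K S).BlockTriangular id := Matrix.blockTriangular_diagonal _
  have h1 : (1 : Matrix (Fin n) (Fin n) K).BlockTriangular id := Matrix.blockTriangular_one
  set d := coordProj K S with hdd
  -- The standard intertwiner of two idempotents: `e * g = e * d = g * d`. As `e` and `d` have the
  -- same diagonal of zeros and ones, `g` is unipotent.
  have hg : (e * d + (1 - e) * (1 - d)).BlockTriangular id :=
    (he.mul hd).add ((h1.sub he).mul (h1.sub hd))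
  refine ⟨e * d + (1 - e) * (1 - d), hg, ?_, ?_⟩
  · rw [Matrix.det_of_isUpperTriangular hg]
    have : ∀ i, (e * d + (1 - e) * (1 - d)) i i = 1 := by
      intro i
      rw [Matrix.add_apply, he.mul_apply_self hd, (h1.sub he).mul_apply_self (h1.sub hd)]
      by_cases hi : i ∈ S
      · simp [hdd, coordProj, hi, (hS i).1 hi]
      · simp [hdd, coordProj, hi, (hS i).2 hi]
    simp [this]
  · have h2 : e * (1 - e) = 0 := by rw [mul_sub, mul_one, hee, sub_self]
    have h3 : (1 - d) * d = 0 := by rw [sub_mul, one_mul, coordProj_mul_self, sub_self]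
    rw [mul_add, add_mul, ← mul_assoc, hee, ← mul_assoc, h2, zero_mul, add_zero, mul_assoc e d d,
      coordProj_mul_self, mul_assoc (1 - e), h3, mul_zero, add_zero]

end Conjugation

/-- The spectral idempotent of `X` at `X i i` commutes with both matrices. Conjugating it to a
coordinate projection reduces to a block pair, and conjugating back preserves the closure. -/
theorem mem_closure_distinctCT_of_X_ne [Infinite K] (hirr : IsIrreducible (CT K (n - 1)))
    {p : MatPair K n} (hp : p ∈ CT K n) {i j : Fin n} (hij : p.X i i ≠ p.X j j) :
    p ∈ closure (distinctCT K n) := by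
  classical
  obtain ⟨q, hq, hqd⟩ := hp.1.exists_idempotent_polynomial (p.X i i)
  set e := Polynomial.aeval p.X q
  have he : e.BlockTriangular id := hp.1.polynomial_aeval q
  have heX : Commute p.X e := (Commute.refl p.X).polynomial_aeval_right q
  have heY : Commute p.Y e :=
    (show Commute p.Y p.X from hp.2.2.symm).polynomial_aeval_right q
  have hed : ∀ k, e k k = q.eval (p.X k k) := hp.1.polynomial_aeval_apply_self q
  let S : Finset (Fin n) := Finset.univ.filter fun k => p.X k k = p.X i i
  have hiS : i ∈ S := Finset.mem_filter.2 ⟨Finset.mem_univ i, rfl⟩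
  have hjS : j ∈ Sᶜ := Finset.mem_compl.2 fun h => hij (Finset.mem_filter.1 h).2.symm
  obtain ⟨g, hg, hdet, hgd⟩ := he.exists_conj_coordProj hq (S := S) fun k => by
    rw [hed]
    exact ⟨fun hk => (hqd k).1 (Finset.mem_filter.1 hk).2,
      fun hk => (hqd k).2 fun h => hk (Finset.mem_filter.2 ⟨Finset.mem_univ k, h⟩)⟩
  have hinv : g⁻¹.BlockTriangular id := hg.inv_of_isUnit_det hdet
  have hdet' : IsUnit g⁻¹.det := Matrix.isUnit_nonsing_inv_det_iff.2 hdet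
  have hginv : g⁻¹⁻¹ = g := Matrix.nonsing_inv_nonsing_inv g hdet
  have hdg : coordProj K S * g⁻¹ = g⁻¹ * e := by
    calc coordProj K S * g⁻¹ = g⁻¹ * g * coordProj K S * g⁻¹ := by
          rw [Matrix.nonsing_inv_mul g hdet, one_mul]
      _ = g⁻¹ * e * (g * g⁻¹) := by rw [mul_assoc g⁻¹, ← hgd]; simp only [mul_assoc]
      _ = _ := by rw [Matrix.mul_nonsing_inv g hdet, mul_one]
  have hcomm : ∀ A : Matrix (Fin n) (Fin n) K, Commute A e →
      coordProj K S * (g⁻¹ * A * g⁻¹⁻¹) = g⁻¹ * A * g⁻¹⁻¹ * coordProj K S := by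
    intro A hA
    rw [hginv, mul_assoc (g⁻¹ * A), ← hgd, ← mul_assoc, ← mul_assoc, hdg, mul_assoc g⁻¹ e A,
      ← hA.eq]
    simp only [mul_assoc]
  have key := mem_closure_distinctCT_of_commute_coordProj hirr ⟨i, hiS⟩ ⟨j, hjS⟩
    (conj_mem_CT hinv hdet' hp) (hcomm _ heX) (hcomm _ heY)
  have := conj_mem_closure_distinctCT hg hdet key
  dsimp only at this
  have hback : ∀ A : Matrix (Fin n) (Fin n) K, g * (g⁻¹ * A * g⁻¹⁻¹) * g⁻¹ = A := by
    intro A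
    rw [hginv]
    calc g * (g⁻¹ * A * g) * g⁻¹ = (g * g⁻¹) * A * (g * g⁻¹) := by simp only [mul_assoc]
      _ = A := by rw [Matrix.mul_nonsing_inv g hdet, one_mul, mul_one]
  rwa [hback, hback] at this

/-- Exchanging the two members of a pair. -/
def MatPair.swap (p : MatPair K n) : MatPair K n := ⟨p.Y, p.X⟩

theorem mem_closure_distinctCT_of_Y_ne [Infinite K] (hirr : IsIrreducible (CT K (n - 1)))
    {p : MatPair K n} (hp : p ∈ CT K n) {i j : Fin n} (hij : p.Y i i ≠ p.Y j j) :
    p ∈ closure (distinctCT K n) := by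
  have hmaps : Set.MapsTo MatPair.swap (distinctCT K n) (distinctCT K n) := fun q hq =>
    ⟨⟨hq.1.2.1, hq.1.1, hq.1.2.2.symm⟩, hq.2.2, hq.2.1⟩
  have hcont : Continuous (MatPair.swap (K := K) (n := n)) :=
    IsRegularMap.continuous_mk MatPair.isInducing_coords .Y .X
  have key := mem_closure_distinctCT_of_X_ne hirr (p := p.swap) ⟨hp.2.1, hp.1, hp.2.2.symm⟩ hij
  exact hmaps.closure hcont key

/-- The upper triangular matrix with given entries. -/
def upperMatrix (x : UpperIndex n → K) : Matrix (Fin n) (Fin n) K :=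
  Matrix.of fun i j => if h : i ≤ j then x ⟨(i, j), h⟩ else 0

theorem upperMatrix_blockTriangular (x : UpperIndex n → K) :
    (upperMatrix x).BlockTriangular id := fun _ _ hij => dif_neg (not_le.2 hij)

theorem upperMatrix_entries {A : Matrix (Fin n) (Fin n) K} (hA : A.BlockTriangular id) :
    upperMatrix (fun ij : UpperIndex n => A ij.1.1 ij.1.2) = A := by
  ext i j
  rw [upperMatrix, Matrix.of_apply]
  split_ifs with h
  · rfl
  · exact (hA (not_le.1 h)).symm

theorem IsRegularMap.upperMatrix {σ : Type*} (f : UpperIndex n → σ) :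
    IsRegularMap (id : (σ → K) → σ → K) fun x => upperMatrix fun ij => x (f ij) := by
  intro i j
  by_cases h : i ≤ j
  · simpa [_root_.upperMatrix, h] using! coord_mem_regularFunctions id (f ⟨(i, j), h⟩)
  · simpa [_root_.upperMatrix, h] using! const_mem_regularFunctions id (0 : K)

/-- The pair consisting of an upper triangular matrix and a polynomial of degree less than `n`
in it. -/
def polynomialPair (x : UpperIndex n ⊕ Fin n → K) : MatPair K n :=
  ⟨upperMatrix fun ij => x (Sum.inl ij),
    ∑ k : Fin n, x (Sum.inr k) • upperMatrix (fun ij => x (Sum.inl ij)) ^ (k : ℕ)⟩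

theorem isRegularMap_polynomialPair_X :
    IsRegularMap id fun x : UpperIndex n ⊕ Fin n → K => (polynomialPair x).X :=
  IsRegularMap.upperMatrix _

theorem isRegularMap_polynomialPair_Y :
    IsRegularMap id fun x : UpperIndex n ⊕ Fin n → K => (polynomialPair x).Y :=
  IsRegularMap.sum (s := Finset.univ) (F := fun (k : Fin n) (x : UpperIndex n ⊕ Fin n → K) =>
      x (Sum.inr k) • upperMatrix (fun ij => x (Sum.inl ij)) ^ (k : ℕ)) fun k _ =>
    IsRegularMap.smul (coord_mem_regularFunctions id (Sum.inr k))
      ((IsRegularMap.upperMatrix Sum.inl).pow k)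

theorem continuous_polynomialPair : Continuous (polynomialPair (K := K) (n := n)) :=
  IsRegularMap.continuous_mk IsInducing.id isRegularMap_polynomialPair_X
    isRegularMap_polynomialPair_Y

theorem polynomialPair_mem_CT (x : UpperIndex n ⊕ Fin n → K) : polynomialPair x ∈ CT K n := by
  have hT := upperMatrix_blockTriangular fun ij => x (Sum.inl ij)
  refine ⟨hT, ?_, ?_⟩
  · exact Subalgebra.sum_mem (Matrix.blockTriangularSubalgebra K K (id : Fin n → Fin n))
      (t := Finset.univ)
      (f := fun k : Fin n => x (Sum.inr k) • upperMatrix (fun ij => x (Sum.inl ij)) ^ (k : ℕ))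
      fun k _ => Subalgebra.smul_mem _ (hT.pow k) _
  · simp only [polynomialPair, Finset.mul_sum, Finset.sum_mul, mul_smul_comm, smul_mul_assoc,
      ← pow_succ, ← pow_succ']

/-- By Cayley–Hamilton `q` may be replaced by its remainder modulo the characteristic polynomial, so
`n` coefficients suffice. -/
theorem mem_range_polynomialPair (hn : n ≠ 0) {p : MatPair K n} (hp : p.X.BlockTriangular id)
    {q : Polynomial K} (hq : p.Y = Polynomial.aeval p.X q) : p ∈ Set.range polynomialPair := by
  let r := q %ₘ p.X.charpoly
  have hr : r.natDegree < n := by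
    have := Polynomial.natDegree_modByMonic_lt q p.X.charpoly_monic (fun h => by
      have := p.X.charpoly_natDegree_eq_dim
      rw [h] at this
      simp at this
      omega)
    rwa [Matrix.charpoly_natDegree_eq_dim, Fintype.card_fin] at this
  refine ⟨Sum.elim (fun ij => p.X ij.1.1 ij.1.2) fun k => r.coeff k, ?_⟩
  ext1
  · exact upperMatrix_entries hp
  · rw [hq, Matrix.aeval_eq_aeval_mod_charpoly, Polynomial.aeval_eq_sum_range' hr,
      Finset.sum_range]
    simp only [polynomialPair, Sum.elim_inl, Sum.elim_inr, upperMatrix_entries hp]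

theorem distinctCT_subset_range_polynomialPair (hn : n ≠ 0) :
    distinctCT K n ⊆ Set.range polynomialPair := by
  intro p hp
  obtain ⟨q, hq⟩ := hp.1.1.exists_aeval_eq_of_injective_diag hp.2.1 hp.1.2.1 hp.1.2.2
  exact mem_range_polynomialPair hn hp.1.1 hq

/-- The parameters form an irreducible affine space, in which distinctness of both diagonals is
open, and nonempty by the example `X = Y` diagonal. -/
theorem range_polynomialPair_subset_closure [IsAlgClosed K] (hn : 2 ≤ n) :
    Set.range polynomialPair ⊆ closure (distinctCT K n) := by
  have hopen := ((isRegularMap_polynomialPair_X (K := K) (n := n)).isOpen_setOf_injOn_diag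
    IsInducing.id Finset.univ ∅).inter
      (isRegularMap_polynomialPair_Y.isOpen_setOf_injOn_diag IsInducing.id Finset.univ ∅)
  obtain ⟨g, hg, -⟩ := exists_injective_notMem_finset (n := n) (∅ : Finset K)
  obtain ⟨x, hx⟩ := mem_range_polynomialPair (by omega)
    (p := ⟨Matrix.diagonal g, Matrix.diagonal g⟩) (Matrix.blockTriangular_diagonal g)
    (q := Polynomial.X) (by simp)
  have hdense := subset_closure_inter_of_isPreirreducible_of_isOpen
    (isIrreducible_univ_affineSpace (K := K)).2 hopen ⟨x, Set.mem_univ x, by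
      simp only [Set.mem_inter_iff, Set.mem_ofPred_eq, hx, Matrix.diag_diagonal]
      simp [hg]⟩
  rintro _ ⟨y, rfl⟩
  refine Set.MapsTo.closure (f := polynomialPair) ?_ continuous_polynomialPair
    (hdense (Set.mem_univ y))
  rintro y ⟨-, ⟨hyX, -⟩, ⟨hyY, -⟩⟩
  exact ⟨polynomialPair_mem_CT y, fun i j h => hyX (by simp) (by simp) h,
    fun i j h => hyY (by simp) (by simp) h⟩

theorem CT0_eq_closure_distinctCT [IsAlgClosed K] (hn : 2 ≤ n)
    (hirr : IsIrreducible (CT K (n - 1))) : CT0 K n = closure (distinctCT K n) := by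
  refine (closure_minimal ?_ isClosed_closure).antisymm closure_distinctCT_subset_CT0
  rintro p ⟨hp, hX, -⟩
  by_cases h : ∃ i j, p.X i i ≠ p.X j j
  · obtain ⟨i, j, hij⟩ := h
    exact mem_closure_distinctCT_of_X_ne hirr hp hij
  -- A regular `X` with one eigenvalue has a cyclic vector, which forces `Y` to be a polynomial in
  -- `X`.
  · push Not at h
    obtain ⟨v, hv⟩ := hp.1.exists_cyclic_of_natDegree_minpoly (by omega)
      (x := p.X ⟨0, by omega⟩ ⟨0, by omega⟩) (fun i => h _ _) hX
    obtain ⟨q, hq⟩ := Matrix.exists_aeval_eq_of_cyclic hp.2.2 v hv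
    exact range_polynomialPair_subset_closure hn (mem_range_polynomialPair (by omega) hp.1 hq)

theorem CT0_eq_closure_range_polynomialPair [IsAlgClosed K] (hn : 2 ≤ n)
    (hirr : IsIrreducible (CT K (n - 1))) : CT0 K n = closure (Set.range polynomialPair) := by
  rw [CT0_eq_closure_distinctCT hn hirr]
  exact (closure_mono (distinctCT_subset_range_polynomialPair (by omega))).antisymm
    (closure_minimal (range_polynomialPair_subset_closure hn) isClosed_closure)

theorem isIrreducible_CT0 [IsAlgClosed K] (hn : 2 ≤ n) (hirr : IsIrreducible (CT K (n - 1))) :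
    IsIrreducible (CT0 K n) := by
  rw [CT0_eq_closure_range_polynomialPair hn hirr, ← Set.image_univ]
  exact (isIrreducible_univ_affineSpace.image _ continuous_polynomialPair.continuousOn).closure

end RegularPairs

/-! ### Dimension of `CT0`, and reduction from constant diagonals to `NT` -/

section DimensionOfNT

open TopologicalSpace Topology MvPolynomial

attribute [local instance] zariskiTopology

theorem topologicalKrullDim_eq_of_invOn {A B : Type*} [TopologicalSpace A] [TopologicalSpace B]
    {S : Set A} {T : Set B} {f : A → B} {g : B → A} (hf : Continuous f) (hg : Continuous g)
    (hST : Set.MapsTo f S T) (hTS : Set.MapsTo g T S) (hinv : Set.InvOn g f S T) :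
    topologicalKrullDim S = topologicalKrullDim T :=
  IsHomeomorph.topologicalKrullDim_eq _
    (Homeomorph.mk ⟨hST.restrict f S T, hTS.restrict g T S, fun a => Subtype.ext (hinv.1 a.2),
      fun b => Subtype.ext (hinv.2 b.2)⟩ (hf.restrict hST) (hg.restrict hTS)).isHomeomorph

theorem topologicalKrullDim_mono {A : Type*} [TopologicalSpace A] {S T : Set A} (h : S ⊆ T) :
    topologicalKrullDim S ≤ topologicalKrullDim T :=
  (IsEmbedding.inclusion h).isInducing.topologicalKrullDim_le

theorem card_strictUpperIndex (n : ℕ) :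
    Fintype.card {ij : Fin n × Fin n // ij.1 < ij.2} = n * (n - 1) / 2 := by
  rw [Fintype.card_subtype, Finset.card_filter, Fintype.sum_prod_type_right]
  have : ∀ j : Fin n, (∑ i : Fin n, if i < j then 1 else 0) = (j : ℕ) := by
    intro j
    rw [← Finset.card_filter, ← Fin.card_Iio j]
    congr 1
    ext i
    simp
  simp only [this]
  rw [← Finset.sum_range fun j => j, Finset.sum_range_id]

theorem card_upperIndex (n : ℕ) : Fintype.card (UpperIndex n) = n * (n + 1) / 2 := by
  rw [Fintype.card_subtype, Finset.card_filter, Fintype.sum_prod_type_right]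
  have : ∀ j : Fin n, (∑ i : Fin n, if i ≤ j then 1 else 0) = (j : ℕ) + 1 := by
    intro j
    rw [← Finset.card_filter, ← Fin.card_Iic j]
    congr 1
    ext i
    simp
  simp only [this]
  rw [← Finset.sum_range fun j => j + 1]
  have := Finset.sum_range_id (n + 1)
  rw [Finset.sum_range_succ'] at this
  rw [add_zero] at this
  rw [this, mul_comm, Nat.add_sub_cancel]

variable {K : Type*} [Field K] {n : ℕ}

theorem topologicalKrullDim_image_coords (S : Set (MatPair K n)) :
    topologicalKrullDim (MatPair.coords '' S) = topologicalKrullDim S :=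
  (IsHomeomorph.topologicalKrullDim_eq _
    (MatPair.isHomeomorph_coords.homeomorph.image S).isHomeomorph).symm

/-- The parametrization has `n(n+1)/2` entries of `X` and `n` coefficients. -/
theorem topologicalKrullDim_CT0_le [IsAlgClosed K] (hn : 2 ≤ n)
    (hirr : IsIrreducible (CT K (n - 1))) :
    topologicalKrullDim (CT0 K n) ≤ ((n * (n + 3) / 2 : ℕ) : WithBot ℕ∞) := by
  rw [CT0_eq_closure_range_polynomialPair hn hirr, ← topologicalKrullDim_image_coords,
    show MatPair.coords '' closure (Set.range (polynomialPair (K := K) (n := n))) =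
      closure (Set.range fun x => (polynomialPair (K := K) (n := n) x).coords) from by
    rw [← MatPair.isHomeomorph_coords.isClosedMap.closure_image_eq_of_continuous
      MatPair.isHomeomorph_coords.continuous, ← Set.range_comp]
    rfl]
  refine (topologicalKrullDim_closure_range_le ?_).trans ?_
  · rintro (⟨i, j⟩ | ⟨i, j⟩)
    · exact isRegularMap_polynomialPair_X i j
    · exact isRegularMap_polynomialPair_Y i j
  · rw [Nat.card_eq_fintype_card, Fintype.card_sum, card_upperIndex, Fintype.card_fin]
    have : n * (n + 3) = n * (n + 1) + n * 2 := by ring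
    rw [this, Nat.add_mul_div_right _ _ two_pos]

/-- The pairs in `CT_n` in which each matrix has constant diagonal. -/
def constDiagCT (K : Type*) [Field K] (n : ℕ) : Set (MatPair K n) :=
  {p | p ∈ CT K n ∧ (∀ i j, p.X i i = p.X j j) ∧ ∀ i j, p.Y i i = p.Y j j}

theorem constDiagCT_subset_CT : constDiagCT K n ⊆ CT K n := fun _ h => h.1

theorem isClosed_constDiagCT : IsClosed (constDiagCT K n) := by
  have hX := IsRegularMap.X (K := K) (n := n)
  have hY := IsRegularMap.Y (K := K) (n := n)
  have hc := MatPair.isInducing_coords (K := K) (n := n)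
  have : constDiagCT K n = CT K n ∩ ((⋂ i, ⋂ j, {p | p.X i i = p.X j j}) ∩
      ⋂ i, ⋂ j, {p | p.Y i i = p.Y j j}) := by
    ext p
    simp only [constDiagCT, Set.mem_ofPred_eq, Set.mem_inter_iff, Set.mem_iInter]
  rw [this]
  exact isClosed_CT.inter ((isClosed_iInter fun i => isClosed_iInter fun j =>
    hX.isClosed_setOf_apply_eq hc i j i j).inter (isClosed_iInter fun i => isClosed_iInter fun j =>
    hY.isClosed_setOf_apply_eq hc i j i j))

theorem isClosed_NT : IsClosed (NT K n) := by
  have hX := IsRegularMap.X (K := K) (n := n)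
  have hY := IsRegularMap.Y (K := K) (n := n)
  have hc := MatPair.isInducing_coords (K := K) (n := n)
  have : NT K n = CT K n ∩ ((⋂ i, ⋂ j, ⋂ _ : j ≤ i, {p | p.X i j = 0}) ∩
      ⋂ i, ⋂ j, ⋂ _ : j ≤ i, {p | p.Y i j = 0}) := by
    ext p
    simp only [NT, Set.mem_ofPred_eq, Set.mem_inter_iff, Set.mem_iInter]
  rw [this]
  exact isClosed_CT.inter ((isClosed_iInter fun i => isClosed_iInter fun j => isClosed_iInter
    fun _ => hX.isClosed_setOf_apply_eq_const hc i j 0).inter (isClosed_iInter fun i =>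
    isClosed_iInter fun j => isClosed_iInter fun _ => hY.isClosed_setOf_apply_eq_const hc i j 0))

theorem CT_subset_CT0_union_constDiagCT [Infinite K] (hirr : IsIrreducible (CT K (n - 1))) :
    CT K n ⊆ CT0 K n ∪ constDiagCT K n := by
  intro p hp
  by_cases hX : ∃ i j, p.X i i ≠ p.X j j
  · obtain ⟨i, j, hij⟩ := hX
    exact Or.inl (closure_distinctCT_subset_CT0 (mem_closure_distinctCT_of_X_ne hirr hp hij))
  by_cases hY : ∃ i j, p.Y i i ≠ p.Y j j
  · obtain ⟨i, j, hij⟩ := hY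
    exact Or.inl (closure_distinctCT_subset_CT0 (mem_closure_distinctCT_of_Y_ne hirr hp hij))
  push Not at hX hY
  exact Or.inr ⟨hp, hX, hY⟩

theorem subset_CT0_or_subset_constDiagCT [Infinite K] (hirr : IsIrreducible (CT K (n - 1)))
    {W : Set (MatPair K n)} (hW : IsIrreducible W) (hWCT : W ⊆ CT K n) :
    W ⊆ CT0 K n ∨ W ⊆ constDiagCT K n :=
  isPreirreducible_iff_isClosed_union_isClosed.1 hW.2 _ _ isClosed_closure isClosed_constDiagCT
    (hWCT.trans (CT_subset_CT0_union_constDiagCT hirr))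

theorem not_CT_subset_constDiagCT [Infinite K] (hn : 2 ≤ n) : ¬ CT K n ⊆ constDiagCT K n := by
  intro h
  obtain ⟨g, hg, -⟩ := exists_injective_notMem_finset (n := n) (∅ : Finset K)
  have := (h (MatPair.diagonal_mem_CT g)).2.1 ⟨0, by omega⟩ ⟨1, by omega⟩
  simp only [Matrix.diagonal_apply_eq] at this
  simpa using hg this

theorem isIrreducible_CT_iff_eq_CT0 [IsAlgClosed K] (hn : 2 ≤ n)
    (hirr : IsIrreducible (CT K (n - 1))) : IsIrreducible (CT K n) ↔ CT K n = CT0 K n := by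
  constructor
  · intro h
    exact ((subset_CT0_or_subset_constDiagCT hirr h subset_rfl).resolve_right
      (not_CT_subset_constDiagCT hn)).antisymm CT0_subset_CT
  · intro h
    rw [h]
    exact isIrreducible_CT0 hn hirr

/-- The pair of scalar matrices with given eigenvalues. -/
def MatPair.scalar (n : ℕ) (x y : K) : MatPair K n := ⟨x • 1, y • 1⟩

theorem add_scalar_mem_CT {p : MatPair K n} (hp : p ∈ CT K n) (x y : K) :
    p + MatPair.scalar n x y ∈ CT K n := by
  have h1 : (1 : Matrix (Fin n) (Fin n) K).BlockTriangular id := Matrix.blockTriangular_one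
  refine ⟨hp.1.add fun i j hij => ?_, hp.2.1.add fun i j hij => ?_, ?_⟩
  · simp [MatPair.scalar, h1 hij]
  · simp [MatPair.scalar, h1 hij]
  · simp only [MatPair.X_add, MatPair.Y_add, MatPair.scalar, add_mul, mul_add, hp.2.2,
      smul_mul_assoc, mul_smul_comm, one_mul, mul_one, smul_add, smul_comm y x]
    abel

theorem add_scalar_mem_closure_distinctCT {p : MatPair K n} (hp : p ∈ closure (distinctCT K n))
    (x y : K) : p + MatPair.scalar n x y ∈ closure (distinctCT K n) := by
  refine Set.MapsTo.closure (f := fun p => p + MatPair.scalar n x y) ?_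
    (MatPair.continuous_add_right _) hp
  intro q hq
  refine ⟨add_scalar_mem_CT hq.1 x y, fun i j hij => hq.2.1 ?_, fun i j hij => hq.2.2 ?_⟩
  · simpa [MatPair.X_add, MatPair.scalar] using hij
  · simpa [MatPair.Y_add, MatPair.scalar] using hij

theorem sub_scalar_mem_NT {p : MatPair K n} (hp : p ∈ constDiagCT K n) {x y : K}
    (hx : ∀ i, p.X i i = x) (hy : ∀ i, p.Y i i = y) : p + MatPair.scalar n (-x) (-y) ∈ NT K n := by
  refine ⟨add_scalar_mem_CT hp.1 _ _, fun i j hij => ?_, fun i j hij => ?_⟩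
  · rcases hij.lt_or_eq with h | rfl
    · simp [MatPair.X_add, MatPair.scalar, hp.1.1 h, h.ne']
    · simp [MatPair.X_add, MatPair.scalar, hx]
  · rcases hij.lt_or_eq with h | rfl
    · simp [MatPair.Y_add, MatPair.scalar, hp.1.2.1 h, h.ne']
    · simp [MatPair.Y_add, MatPair.scalar, hy]

theorem add_scalar_neg_add_scalar (p : MatPair K n) (x y : K) :
    p + MatPair.scalar n (-x) (-y) + MatPair.scalar n x y = p := by
  ext1
  · simp [MatPair.X_add, MatPair.scalar, add_assoc]
  · simp [MatPair.Y_add, MatPair.scalar, add_assoc]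

theorem add_scalar_mem_constDiagCT {p : MatPair K n} (hp : p ∈ NT K n) (x y : K) :
    p + MatPair.scalar n x y ∈ constDiagCT K n := by
  refine ⟨add_scalar_mem_CT hp.1 x y, fun i j => ?_, fun i j => ?_⟩
  · simp [MatPair.X_add, MatPair.scalar, hp.2.1 i i le_rfl, hp.2.1 j j le_rfl]
  · simp [MatPair.Y_add, MatPair.scalar, hp.2.2 i i le_rfl, hp.2.2 j j le_rfl]

/-- Subtracting scalars moves a constant-diagonal pair into `NT`; adding them back stays in `CT0`,
since translation by scalars preserves distinctness of the diagonals. -/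
theorem isIrreducible_CT_iff_NT_subset [IsAlgClosed K] (hn : 2 ≤ n)
    (hirr : IsIrreducible (CT K (n - 1))) : IsIrreducible (CT K n) ↔ NT K n ⊆ CT0 K n := by
  rw [isIrreducible_CT_iff_eq_CT0 hn hirr]
  refine ⟨fun h => h ▸ fun _ hp => hp.1, fun h => Set.Subset.antisymm ?_ CT0_subset_CT⟩
  intro p hp
  refine (CT_subset_CT0_union_constDiagCT hirr hp).elim id fun hp' => ?_
  let i0 : Fin n := ⟨0, by omega⟩
  have h' := h (sub_scalar_mem_NT hp' (fun i => hp'.2.1 i i0) (fun i => hp'.2.2 i i0))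
  rw [CT0_eq_closure_distinctCT hn hirr] at h' ⊢
  have := add_scalar_mem_closure_distinctCT h' (p.X i0 i0) (p.Y i0 i0)
  rwa [add_scalar_neg_add_scalar] at this

theorem topologicalKrullDim_constDiagCT [IsAlgClosed K] (hn : 2 ≤ n) :
    topologicalKrullDim (constDiagCT K n) = topologicalKrullDim (NT K n) + 2 := by
  have h := topologicalKrullDim_preimage_comp_inr (ι := Fin 2)
    (MatPair.isHomeomorph_coords.isClosedMap _ (isClosed_NT (K := K) (n := n)))
  rw [topologicalKrullDim_image_coords, Nat.card_eq_fintype_card, Fintype.card_fin] at h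
  refine Eq.trans ?_ h
  let i0 : Fin n := ⟨0, by omega⟩
  -- These maps identify `constDiagCT` with the product of the affine plane and `NT`: `f` records
  -- the two eigenvalues and removes them from the diagonals, `g` restores them.
  let f : MatPair K n → (Fin 2 ⊕ ((Fin n × Fin n) ⊕ (Fin n × Fin n)) → K) := fun p =>
    Sum.elim ![p.X i0 i0, p.Y i0 i0] (p + MatPair.scalar n (-p.X i0 i0) (-p.Y i0 i0)).coords
  let g : (Fin 2 ⊕ ((Fin n × Fin n) ⊕ (Fin n × Fin n)) → K) → MatPair K n := fun x =>
    MatPair.ofCoords (x ∘ Sum.inr) + MatPair.scalar n (x (Sum.inl 0)) (x (Sum.inl 1))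
  have hgf : ∀ p, g (f p) = p := by
    intro p
    have : f p ∘ Sum.inr = (p + MatPair.scalar n (-p.X i0 i0) (-p.Y i0 i0)).coords := rfl
    simp only [g]
    rw [this, MatPair.ofCoords_coords]
    exact add_scalar_neg_add_scalar p _ _
  have hXr : IsRegularMap MatPair.coords fun p : MatPair K n => p.X + (-p.X i0 i0) • 1 :=
    IsRegularMap.X.add (IsRegularMap.smul
      (neg_mem_regularFunctions (IsRegularMap.X i0 i0)) (IsRegularMap.const 1))
  have hYr : IsRegularMap MatPair.coords fun p : MatPair K n => p.Y + (-p.Y i0 i0) • 1 :=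
    IsRegularMap.Y.add (IsRegularMap.smul
      (neg_mem_regularFunctions (IsRegularMap.Y i0 i0)) (IsRegularMap.const 1))
  refine topologicalKrullDim_eq_of_invOn (f := f) (g := g) ?_ ?_ ?_ ?_
    ⟨fun p _ => hgf p, fun x hx => ?_⟩
  · refine continuous_of_regular MatPair.isInducing_coords IsInducing.id ?_
    rintro (k | ⟨i, j⟩ | ⟨i, j⟩)
    · fin_cases k
      · exact IsRegularMap.X i0 i0
      · exact IsRegularMap.Y i0 i0
    · exact hXr i j
    · exact hYr i j
  · refine IsRegularMap.continuous_mk (c := id) IsInducing.id (IsRegularMap.add ?_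
      (IsRegularMap.smul (coord_mem_regularFunctions id (Sum.inl 0)) (IsRegularMap.const 1)))
      (IsRegularMap.add ?_
      (IsRegularMap.smul (coord_mem_regularFunctions id (Sum.inl 1)) (IsRegularMap.const 1)))
    · exact fun i j => coord_mem_regularFunctions id (Sum.inr (Sum.inl (i, j)))
    · exact fun i j => coord_mem_regularFunctions id (Sum.inr (Sum.inr (i, j)))
  · intro p hp
    exact ⟨_, sub_scalar_mem_NT hp (fun i => hp.2.1 i i0) (fun i => hp.2.2 i i0), rfl⟩
  · rintro x ⟨p, hp, hpx⟩
    simp only [g]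
    rw [← hpx, MatPair.ofCoords_coords]
    exact add_scalar_mem_constDiagCT hp _ _
  · obtain ⟨p, hp, hpx⟩ := hx
    have hX0 : (g x).X i0 i0 = x (Sum.inl 0) := by
      simp only [g]
      rw [← hpx, MatPair.ofCoords_coords]
      simp [MatPair.X_add, MatPair.scalar, hp.2.1 i0 i0 le_rfl]
    have hY0 : (g x).Y i0 i0 = x (Sum.inl 1) := by
      simp only [g]
      rw [← hpx, MatPair.ofCoords_coords]
      simp [MatPair.Y_add, MatPair.scalar, hp.2.2 i0 i0 le_rfl]
    ext (k | s)
    · fin_cases k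
      · exact hX0
      · exact hY0
    · have : (g x + MatPair.scalar n (-(g x).X i0 i0) (-(g x).Y i0 i0)) =
          MatPair.ofCoords (x ∘ Sum.inr) := by
        rw [hX0, hY0]
        have h2 := add_scalar_neg_add_scalar (MatPair.ofCoords (x ∘ Sum.inr))
          (-x (Sum.inl 0)) (-x (Sum.inl 1))
        rwa [neg_neg, neg_neg] at h2
      change (g x + MatPair.scalar n (-(g x).X i0 i0) (-(g x).Y i0 i0)).coords s = _
      rw [this, MatPair.coords_ofCoords]
      rfl

end DimensionOfNT

/-! ### The commutator ideal and its zero locus -/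

section CommutatorIdeal

open TopologicalSpace Topology MvPolynomial

attribute [local instance] zariskiTopology

variable {K : Type*} [Field K] {n : ℕ}

/-- The pair of upper triangular matrices with given entries. -/
def upperPair (x : UpperIndex n ⊕ UpperIndex n → K) : MatPair K n :=
  ⟨upperMatrix fun ij => x (Sum.inl ij), upperMatrix fun ij => x (Sum.inr ij)⟩

/-- The entries on and above the diagonal. -/
def MatPair.upperEntries (p : MatPair K n) : UpperIndex n ⊕ UpperIndex n → K :=
  Sum.elim (fun ij => p.X ij.1.1 ij.1.2) fun ij => p.Y ij.1.1 ij.1.2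

theorem continuous_upperPair : Continuous (upperPair (K := K) (n := n)) :=
  IsRegularMap.continuous_mk IsInducing.id (.upperMatrix _) (.upperMatrix _)

theorem MatPair.continuous_upperEntries : Continuous (upperEntries (K := K) (n := n)) :=
  continuous_of_regular isInducing_coords IsInducing.id (by
    rintro (ij | ij)
    · exact IsRegularMap.X ij.1.1 ij.1.2
    · exact IsRegularMap.Y ij.1.1 ij.1.2)

theorem upperPair_upperEntries {p : MatPair K n} (hp : p ∈ CT K n) :
    upperPair p.upperEntries = p := by
  ext1
  · exact upperMatrix_entries hp.1
  · exact upperMatrix_entries hp.2.1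

theorem upperEntries_upperPair (x : UpperIndex n ⊕ UpperIndex n → K) :
    (upperPair x).upperEntries = x := by
  ext (⟨⟨i, j⟩, h⟩ | ⟨⟨i, j⟩, h⟩)
  · exact dif_pos h
  · exact dif_pos h

theorem aeval_genericX (x : UpperIndex n ⊕ UpperIndex n → K) (i j : Fin n) :
    aeval x (genericX K n i j) = (upperPair x).X i j := by
  by_cases h : i ≤ j <;> simp [genericX, upperPair, upperMatrix, h]

theorem aeval_genericY (x : UpperIndex n ⊕ UpperIndex n → K) (i j : Fin n) :
    aeval x (genericY K n i j) = (upperPair x).Y i j := by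
  by_cases h : i ≤ j <;> simp [genericY, upperPair, upperMatrix, h]

theorem mem_zeroLocus_commutatorIdeal {x : UpperIndex n ⊕ UpperIndex n → K} :
    x ∈ zeroLocus K (commutatorIdeal K n) ↔ upperPair x ∈ CT K n := by
  have hX : (upperPair x).X.BlockTriangular id :=
    upperMatrix_blockTriangular fun ij => x (Sum.inl ij)
  have hY : (upperPair x).Y.BlockTriangular id :=
    upperMatrix_blockTriangular fun ij => x (Sum.inr ij)
  have hev : ∀ i j, aeval x ((genericX K n * genericY K n - genericY K n * genericX K n) i j) =
      ((upperPair x).X * (upperPair x).Y) i j - ((upperPair x).Y * (upperPair x).X) i j := by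
    intro i j
    simp only [Matrix.sub_apply, Matrix.mul_apply, map_sub, map_sum, map_mul, aeval_genericX,
      aeval_genericY]
  rw [commutatorIdeal, zeroLocus_span]
  constructor
  · intro h
    refine ⟨hX, hY, ?_⟩
    ext i j
    rw [← sub_eq_zero]
    rcases lt_trichotomy i j with hij | rfl | hij
    · rw [← hev]
      exact h _ ⟨i, j, hij, rfl⟩
    · rw [hX.mul_apply_self hY, hY.mul_apply_self hX, mul_comm, sub_self]
    · rw [hX.mul hY hij, hY.mul hX hij, sub_self]
  · rintro ⟨-, -, h⟩ _ ⟨i, j, -, rfl⟩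
    rw [hev, h, sub_self]

theorem upperEntries_mem_zeroLocus {p : MatPair K n} (hp : p ∈ CT K n) :
    p.upperEntries ∈ zeroLocus K (commutatorIdeal K n) := by
  rwa [mem_zeroLocus_commutatorIdeal, upperPair_upperEntries hp]

theorem upperPair_image_zeroLocus_subset {P : Ideal (UpperPairRing K n)}
    (hP : commutatorIdeal K n ≤ P) : upperPair '' zeroLocus K P ⊆ CT K n := by
  rintro _ ⟨x, hx, rfl⟩
  exact mem_zeroLocus_commutatorIdeal.1 (zeroLocus_anti_mono hP hx)

theorem topologicalKrullDim_upperPair_image [IsAlgClosed K] (P : Ideal (UpperPairRing K n)) :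
    topologicalKrullDim (upperPair '' zeroLocus K P) = ringKrullDim (UpperPairRing K n ⧸ P) := by
  rw [← topologicalKrullDim_zeroLocus]
  refine (topologicalKrullDim_eq_of_invOn continuous_upperPair MatPair.continuous_upperEntries
    (Set.mapsTo_image _ _) ?_ ⟨fun x _ => upperEntries_upperPair x, ?_⟩).symm
  · rintro _ ⟨x, hx, rfl⟩
    rwa [upperEntries_upperPair]
  · rintro _ ⟨x, hx, rfl⟩
    rw [upperEntries_upperPair]

theorem ringKrullDim_quotient_commutatorIdeal [IsAlgClosed K] :
    ringKrullDim (UpperPairRing K n ⧸ commutatorIdeal K n) = topologicalKrullDim (CT K n) := by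
  have h : upperPair '' zeroLocus K (commutatorIdeal K n) = CT K n :=
    (upperPair_image_zeroLocus_subset le_rfl).antisymm fun p hp =>
      ⟨p.upperEntries, upperEntries_mem_zeroLocus hp, upperPair_upperEntries hp⟩
  rw [← topologicalKrullDim_upperPair_image, h]

theorem isIrreducible_upperPair_image [IsAlgClosed K] (P : Ideal (UpperPairRing K n))
    [P.IsPrime] : IsIrreducible (upperPair '' zeroLocus K P) :=
  (isIrreducible_zeroLocus P).image _ continuous_upperPair.continuousOn

theorem commutatorIdeal_ne_top : commutatorIdeal K n ≠ ⊤ := by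
  intro h
  have := upperEntries_mem_zeroLocus (MatPair.diagonal_mem_CT (0 : Fin n → K))
  rw [h, zeroLocus_top] at this
  exact this

theorem spanFinrank_commutatorIdeal_le : (commutatorIdeal K n).spanFinrank ≤ n * (n - 1) / 2 := by
  let g : {ij : Fin n × Fin n // ij.1 < ij.2} → UpperPairRing K n := fun ij =>
    (genericX K n * genericY K n - genericY K n * genericX K n) ij.1.1 ij.1.2
  have hspan : commutatorIdeal K n = Ideal.span (Set.range g) := by
    rw [commutatorIdeal]
    congr 1
    ext f
    constructor
    · rintro ⟨i, j, hij, rfl⟩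
      exact ⟨⟨(i, j), hij⟩, rfl⟩
    · rintro ⟨⟨⟨i, j⟩, hij⟩, rfl⟩
      exact ⟨i, j, hij, rfl⟩
  rw [hspan, ← card_strictUpperIndex, ← Nat.card_eq_fintype_card]
  refine (Submodule.spanFinrank_span_le_ncard_of_finite (Set.finite_range g)).trans ?_
  rw [← Set.image_univ, ← Set.ncard_univ]
  exact Set.ncard_image_le Set.finite_univ

/-- The ambient dimension is the number of equations plus the dimension bound for `CT0`; this
coincidence makes the lower and upper estimates meet. -/
theorem card_upperIndex_sum :
    Nat.card (UpperIndex n ⊕ UpperIndex n) = n * (n - 1) / 2 + n * (n + 3) / 2 := by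
  rw [Nat.card_eq_fintype_card, Fintype.card_sum, card_upperIndex]
  have h1 : n * (n + 3) = n * (n + 1) + n * 2 := by ring
  have h2 : n * (n + 1) = n * (n - 1) + n * 2 := by
    cases n with
    | zero => rfl
    | succ m => rw [Nat.add_sub_cancel]; ring
  rw [h1, Nat.add_mul_div_right _ _ two_pos, h2, Nat.add_mul_div_right _ _ two_pos]
  omega

theorem ringKrullDim_upperPairRing :
    ringKrullDim (UpperPairRing K n) = ((n * (n - 1) / 2 + n * (n + 3) / 2 : ℕ) : WithBot ℕ∞) := by
  rw [← card_upperIndex_sum, MvPolynomial.ringKrullDim_of_isNoetherianRing,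
    ringKrullDim_eq_zero_of_field, zero_add]

end CommutatorIdeal

/-! ### Cancellation for dimensions that may be infinite or `⊥` -/

section Arithmetic

theorem WithBot.lt_natCast_of_add_one_le {a : WithBot ℕ∞} {m : ℕ}
    (h : a + 1 ≤ (m : WithBot ℕ∞)) : a < m := by
  induction a with
  | bot => exact WithBot.bot_lt_coe _
  | coe a =>
    have h' : a + 1 ≤ (m : ℕ∞) := WithBot.coe_le_coe.1 h
    exact WithBot.coe_lt_coe.2 ((ENat.add_one_le_iff (by rintro rfl; simp at h')).1 h')

theorem WithBot.le_natCast_of_natCast_add_le {a : WithBot ℕ∞} {k m : ℕ}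
    (h : (k : WithBot ℕ∞) + a ≤ ((k + m : ℕ) : WithBot ℕ∞)) : a ≤ m := by
  induction a with
  | bot => exact bot_le
  | coe a =>
    have h' : (k : ℕ∞) + a ≤ ((k + m : ℕ) : ℕ∞) := WithBot.coe_le_coe.1 h
    rw [Nat.cast_add] at h'
    exact WithBot.coe_le_coe.2 ((ENat.add_le_add_iff_left (ENat.natCast_ne_top k)).1 h')

theorem WithBot.natCast_le_of_natCast_add_le {a : ℕ∞} {b : WithBot ℕ∞} {k m : ℕ}
    (h : ((k + m : ℕ) : WithBot ℕ∞) ≤ b + (a : WithBot ℕ∞)) (hb : b ≤ m) : (k : ℕ∞) ≤ a := by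
  have h1 : ((k + m : ℕ) : WithBot ℕ∞) ≤ (m : WithBot ℕ∞) + (a : WithBot ℕ∞) :=
    h.trans (by gcongr)
  have h2 : ((k + m : ℕ) : ℕ∞) ≤ (m : ℕ∞) + a := WithBot.coe_le_coe.1 h1
  rw [Nat.cast_add, add_comm] at h2
  exact (ENat.add_le_add_iff_left (ENat.natCast_ne_top m)).1 h2

end Arithmetic

/-! ### Dimension criteria for irreducibility and complete intersection -/

section Criteria

open TopologicalSpace Topology MvPolynomial

attribute [local instance] zariskiTopology

variable {K : Type*} [Field K] [IsAlgClosed K] {n : ℕ}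

theorem le_topologicalKrullDim_upperPair_image {P : Ideal (UpperPairRing K n)}
    (hP : P ∈ (commutatorIdeal K n).minimalPrimes) :
    ((n * (n + 3) / 2 : ℕ) : WithBot ℕ∞) ≤ topologicalKrullDim (upperPair '' zeroLocus K P) := by
  have h := card_le_ringKrullDim_quotient_add_spanFinrank hP
  rw [card_upperIndex_sum, ← topologicalKrullDim_upperPair_image] at h
  by_contra! hlt
  generalize topologicalKrullDim (upperPair '' zeroLocus K P) = a at h hlt
  have h' : ((n * (n - 1) / 2 + n * (n + 3) / 2 : ℕ) : WithBot ℕ∞) ≤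
      a + ((n * (n - 1) / 2 : ℕ) : WithBot ℕ∞) :=
    h.trans (by gcongr; exact_mod_cast spanFinrank_commutatorIdeal_le)
  induction a with
  | bot => exact absurd h' (by rw [WithBot.bot_add]; exact not_le.2 (WithBot.bot_lt_coe _))
  | coe a =>
    have h1 : ((n * (n - 1) / 2 + n * (n + 3) / 2 : ℕ) : ℕ∞) ≤ a + (n * (n - 1) / 2 : ℕ) :=
      WithBot.coe_le_coe.1 h'
    rw [Nat.cast_add, add_comm a] at h1
    exact absurd (WithBot.coe_lt_coe.1 hlt)
      (not_lt.2 ((ENat.add_le_add_iff_left (ENat.natCast_ne_top _)).1 h1))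

theorem mem_CT0_of_nontrivial_spectrum (hirr : IsIrreducible (CT K (n - 1))) {p : MatPair K n}
    (hp : p ∈ CT K n) (h : (spectrum K p.X).Nontrivial ∨ (spectrum K p.Y).Nontrivial) :
    p ∈ CT0 K n := by
  rw [hp.1.nontrivial_spectrum_iff, hp.2.1.nontrivial_spectrum_iff] at h
  rcases h with ⟨i, j, hij⟩ | ⟨i, j, hij⟩
  · exact closure_distinctCT_subset_CT0 (mem_closure_distinctCT_of_X_ne hirr hp hij)
  · exact closure_distinctCT_subset_CT0 (mem_closure_distinctCT_of_Y_ne hirr hp hij)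

/-- A component inside `CT0` equals it by maximality, because `CT0` is itself irreducible; any other
component falls under the second alternative. -/
theorem image_irreducibleComponent_subset_constDiagCT (hn : 2 ≤ n)
    (hirr : IsIrreducible (CT K (n - 1))) {Z : Set (CT K n)}
    (hZ : Z ∈ irreducibleComponents (CT K n))
    (hne : ((↑) '' Z : Set (MatPair K n)) ≠ CT0 K n) :
    ((↑) '' Z : Set (MatPair K n)) ⊆ constDiagCT K n := by
  have hval : IsInducing (Subtype.val : CT K n → MatPair K n) := IsInducing.subtypeVal
  have hZirr : IsIrreducible Z := hZ.1
  refine (subset_CT0_or_subset_constDiagCT hirr (hval.isIrreducible_image_iff.2 hZirr)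
    (Subtype.coe_image_subset _ _)).resolve_left fun hsub => hne ?_
  have himg : Subtype.val '' (Subtype.val ⁻¹' CT0 K n : Set (CT K n)) = CT0 K n := by
    rw [Set.image_preimage_eq_iff, Subtype.range_coe]
    exact CT0_subset_CT
  have hirr0 : IsIrreducible (Subtype.val ⁻¹' CT0 K n : Set (CT K n)) := by
    rw [← hval.isIrreducible_image_iff, himg]
    exact isIrreducible_CT0 hn hirr
  exact hsub.antisymm (himg ▸ Set.image_mono (hZ.2 hirr0 (Set.image_subset_iff.1 hsub)))

theorem topologicalKrullDim_constDiagCT_lt (hn : 2 ≤ n) (hirr : IsIrreducible (CT K (n - 1)))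
    (h : IsIrreducible (CT K n)) :
    topologicalKrullDim (constDiagCT K n) < ((n * (n + 3) / 2 : ℕ) : WithBot ℕ∞) := by
  refine WithBot.lt_natCast_of_add_one_le (le_trans ?_ (topologicalKrullDim_CT0_le hn hirr))
  rw [← (isIrreducible_CT_iff_eq_CT0 hn hirr).1 h, ← topologicalKrullDim_image_coords,
    ← topologicalKrullDim_image_coords (CT K n)]
  have hc := MatPair.isHomeomorph_coords (K := K) (n := n)
  refine topologicalKrullDim_add_one_le_of_ssubset (hc.isClosedMap _ isClosed_CT)
    (h.image _ hc.continuous.continuousOn) (hc.isClosedMap _ isClosed_constDiagCT) ?_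
  exact ⟨Set.image_mono constDiagCT_subset_CT, fun hsub =>
    not_CT_subset_constDiagCT hn ((Set.image_subset_image_iff hc.injective).1 hsub)⟩

/-- Each point lies on the locus of a minimal prime, whose dimension is too large to fit in
`constDiagCT`, so that locus lies in `CT0`. -/
theorem isIrreducible_CT_of_topologicalKrullDim_lt (hn : 2 ≤ n)
    (hirr : IsIrreducible (CT K (n - 1)))
    (h : topologicalKrullDim (constDiagCT K n) < ((n * (n + 3) / 2 : ℕ) : WithBot ℕ∞)) :
    IsIrreducible (CT K n) := by
  rw [isIrreducible_CT_iff_eq_CT0 hn hirr]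
  refine Set.Subset.antisymm (fun p hp => ?_) CT0_subset_CT
  have hle : commutatorIdeal K n ≤ vanishingIdeal K {p.upperEntries} := by
    rintro f hf _ rfl
    exact upperEntries_mem_zeroLocus hp f hf
  obtain ⟨P, hP, hPp⟩ := Ideal.exists_minimalPrimes_le hle
  have : P.IsPrime := hP.1.1
  rcases subset_CT0_or_subset_constDiagCT hirr (isIrreducible_upperPair_image P)
    (upperPair_image_zeroLocus_subset hP.1.2) with hsub | hsub
  · exact hsub ⟨p.upperEntries, fun f hf => hPp hf _ rfl, upperPair_upperEntries hp⟩
  · exact absurd h (not_lt.2 ((le_topologicalKrullDim_upperPair_image hP).trans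
      (topologicalKrullDim_mono hsub)))

/-- Full height bounds the dimension of `CT` from above. Conversely each minimal prime has its locus
in `CT0` or in `constDiagCT`, both of dimension at most `n(n+3)/2`, so its height is at least the
number of equations; Krull gives the opposite bound. -/
theorem CTIsCompleteIntersection_iff_topologicalKrullDim_le (hn : 2 ≤ n)
    (hirr : IsIrreducible (CT K (n - 1))) :
    CTIsCompleteIntersection K n ↔
      topologicalKrullDim (constDiagCT K n) ≤ ((n * (n + 3) / 2 : ℕ) : WithBot ℕ∞) := by
  constructor
  · intro h
    refine (topologicalKrullDim_mono constDiagCT_subset_CT).trans ?_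
    have key := height_add_ringKrullDim_quotient_le (commutatorIdeal K n) commutatorIdeal_ne_top
    rw [h, ringKrullDim_quotient_commutatorIdeal, ringKrullDim_upperPairRing] at key
    exact WithBot.le_natCast_of_natCast_add_le key
  · intro h
    refine le_antisymm (((commutatorIdeal K n).height_le_spanFinrank commutatorIdeal_ne_top).trans
      (by exact_mod_cast spanFinrank_commutatorIdeal_le)) ?_
    rw [Ideal.height_eq_inf_minimalPrimes]
    refine le_iInf₂ fun P hP => ?_
    have : P.IsPrime := hP.1.1
    have key := card_le_ringKrullDim_quotient_add_height P
    rw [card_upperIndex_sum, ← topologicalKrullDim_upperPair_image] at key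
    refine WithBot.natCast_le_of_natCast_add_le key ?_
    rcases subset_CT0_or_subset_constDiagCT hirr (isIrreducible_upperPair_image P)
      (upperPair_image_zeroLocus_subset hP.1.2) with hsub | hsub
    · exact (topologicalKrullDim_mono hsub).trans (topologicalKrullDim_CT0_le hn hirr)
    · exact (topologicalKrullDim_mono hsub).trans h

end Criteria

end

theorem proposition6 (K : Type*) [Field K] [IsAlgClosed K] (n : ℕ) (hn : 2 ≤ n)
    (hirr : IsIrreducible (CT K (n - 1))) :
    -- pairs in which one of the two matrices has at least two eigenvalues lie in `CT_n^0`
    (∀ p ∈ CT K n, ((spectrum K p.X).Nontrivial ∨ (spectrum K p.Y).Nontrivial) → p ∈ CT0 K n) ∧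
    -- on any other irreducible component both matrices have exactly one eigenvalue
    (∀ Z ∈ irreducibleComponents (CT K n), ((↑) '' Z : Set (MatPair K n)) ≠ CT0 K n →
      ∀ p ∈ Z, (∃ x : K, spectrum K (p : MatPair K n).X = {x}) ∧
        ∃ y : K, spectrum K (p : MatPair K n).Y = {y}) ∧
    -- irreducibility of `CT_n` is decided on `NT_n`, and indeed by the dimension of `NT_n`
    (IsIrreducible (CT K n) ↔ NT K n ⊆ CT0 K n) ∧
    (IsIrreducible (CT K n) ↔
      topologicalKrullDim (NT K n) + 2 < ((n * (n + 3) / 2 : ℕ) : WithBot ℕ∞)) ∧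
    -- so is the property of being a complete intersection
    (CTIsCompleteIntersection K n ↔
      topologicalKrullDim (NT K n) + 2 ≤ ((n * (n + 3) / 2 : ℕ) : WithBot ℕ∞)) := by
  rw [← topologicalKrullDim_constDiagCT hn]
  refine ⟨fun p hp h => mem_CT0_of_nontrivial_spectrum hirr hp h, fun Z hZ hne p hp => ?_,
    isIrreducible_CT_iff_NT_subset hn hirr,
    ⟨topologicalKrullDim_constDiagCT_lt hn hirr, isIrreducible_CT_of_topologicalKrullDim_lt hn hirr⟩,
    CTIsCompleteIntersection_iff_topologicalKrullDim_le hn hirr⟩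
  obtain ⟨-, hX, hY⟩ := image_irreducibleComponent_subset_constDiagCT hn hirr hZ hne ⟨p, hp, rfl⟩
  exact ⟨p.2.1.exists_spectrum_eq_singleton (by omega) hX,
    p.2.2.1.exists_spectrum_eq_singleton (by omega) hY⟩
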